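/- Let $p$ be a prime. For a group $H$ and a subgroup $K\le H$, let $K^p$ be the subgroup generated by the $p$-th powers of elements of $K$. The lower $p$-series $H=H_1\ge H_2\ge\cdots$ of $H$ is defined by $H_{i+1}=H_i^p[H_i,H]$ for $i\ge 1$. In particular, for a subgroup $U$ of a group, $U_2=U^p[U,U]$. The rank of an elementary abelian $p$-group is its dimension over $\mathbb{F}_p$, that is, its minimal number of generators. Let $d\ge 3$ and $n\ge 2$ be integers and let $F$ be the free group on $d$ generators. (1) Let $U$ be a normal subgroup of $F$ with $U\le F_2$, and put $$Q=(U\cap F_n)F_{n+1}/F_{n+1},\qquad R=(U_2\cap F_{n+1})F_{n+2}/F_{n+2},\qquad S=(U^p[U,F]\cap F_{n+1})F_{n+2}/F_{n+2}.$$ Then $Q$, $R$, $S$ have finite rank, $\operatorname{rank}(R)\ge\operatorname{rank}(Q)$ and $\operatorname{rank}(S)\ge\tfrac32\operatorname{rank}(Q)$. (2) Let $G=F/F_{n+1}$, let $i$ be an integer with $2\le i<n$, let $U$ be a normal subgroup of $G$ with $U\le G_2$, and put $$Q=(U\cap G_i)G_{i+1}/G_{i+1},\qquad R=(U_2\cap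 G_{i+1})G_{i+2}/G_{i+2},\qquad S=(U^p[U,G]\cap G_{i+1})G_{i+2}/G_{i+2}.$$ Then $Q$, $R$, $S$ have finite rank, $\operatorname{rank}(R)\ge\operatorname{rank}(Q)$ and $\operatorname{rank}(S)\ge\tfrac32\operatorname{rank}(Q)$. -/

import Mathlib

/-- `K ^ p`: the subgroup generated by the `p`-th powers of the elements of `K`. -/
def powSubgroup {H : Type*} [Group H] (p : ℕ) (K : Subgroup H) : Subgroup H :=
  Subgroup.closure {y : H | ∃ x ∈ K, x ^ p = y}

/-- `K ^ p [K, H]`. For normal `K` both factors are normal, so that their join is their product. -/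
def powComm {H : Type*} [Group H] (p : ℕ) (K : Subgroup H) : Subgroup H :=
  powSubgroup p K ⊔ ⁅K, (⊤ : Subgroup H)⁆

/-- The lower `p`-series `H = H_1 ≥ H_2 ≥ ⋯` with `H_{i+1} = H_i ^ p [H_i, H]`,
indexed from `1`; the index `0` is not used and gives `H`. -/
def lowerPSeries (p : ℕ) (H : Type*) [Group H] : ℕ → Subgroup H
  | 0 => ⊤
  | 1 => ⊤
  | i + 2 => powComm p (lowerPSeries p H (i + 1))

theorem powSubgroup_normal {H : Type*} [Group H] (p : ℕ) (K : Subgroup H) [hK : K.Normal] :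
    (powSubgroup p K).Normal := by
  refine ⟨fun a ha g => ?_⟩
  unfold powSubgroup at ha ⊢
  induction ha using Subgroup.closure_induction with
  | mem y hy =>
    obtain ⟨x, hx, rfl⟩ := hy
    exact Subgroup.subset_closure ⟨g * x * g⁻¹, hK.conj_mem x hx g, conj_pow⟩
  | one => simp
  | mul a b _ _ iha ihb => simpa [mul_assoc] using mul_mem iha ihb
  | inv a _ iha => simpa [mul_assoc] using inv_mem iha

theorem powComm_normal {H : Type*} [Group H] (p : ℕ) (K : Subgroup H) [K.Normal] :
    (powComm p K).Normal := by
  have := powSubgroup_normal p K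
  unfold powComm
  infer_instance

instance lowerPSeries_normal (p : ℕ) (H : Type*) [Group H] (i : ℕ) :
    (lowerPSeries p H i).Normal := by
  induction i with
  | zero => unfold lowerPSeries; infer_instance
  | succ i ih =>
    cases i with
    | zero => unfold lowerPSeries; infer_instance
    | succ i => unfold lowerPSeries; exact powComm_normal p _

/-- The term `U_2` of the lower `p`-series of the group `U` itself, as a subgroup of `H`. -/
def secondTerm {H : Type*} [Group H] (p : ℕ) (U : Subgroup H) : Subgroup H :=
  (lowerPSeries p U 2).map U.subtype

/-- The subgroup `(K ∩ H_i) H_{i+1} / H_{i+1}` of `H / H_{i+1}`. -/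
def layer {H : Type*} [Group H] (p : ℕ) (K : Subgroup H) (i : ℕ) :
    Subgroup (H ⧸ lowerPSeries p H (i + 1)) :=
  ((K ⊓ lowerPSeries p H i) ⊔ lowerPSeries p H (i + 1)).map
    (QuotientGroup.mk' (lowerPSeries p H (i + 1)))

/-! Write P_n for the n-th term of the lower p-series of the free group. The Magnus map a ↦ 1 + X_a
sends P_n into 1 + J_n, where J_n is the set of integral series whose coefficient at w is divisible
by p^(n-|w|). Dividing by this power and reducing mod p gives `sigma`, which embeds P_n / P_{n+1}
into the F_p-valued functions on words of length at most n (`sigma_eq_zero_iff`). Indeed p-power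
powers of Hall commutators generate the layer (`lowerPSeries_le_powSpan`), and their expansions have
distinct leading Lyndon words (`minLead_comm`), so a triangularity argument gives injectivity.

For n ≥ 2 the p-th power map leaves the function unchanged (`sigma_pow`), and the commutator with a
generator a becomes v ↦ v X_a - X_a v (`sigma_commutator`). Let V be the space of functions
belonging to Q. The space of R contains V, whence the first inequality. The space W of S contains V
and all brackets [V, X_a].

The dimension of such a space is the number of leading words of its elements, for any total order.
The order `key` uses a distinguished letter z, and x is the largest letter. A leading word u of V
gives these leading words of W: u itself; au for a ≠ z, if z occurs in u; xu, if z does not occur in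
u and u is not a power of x; uz, if u is not a power of z. By `sigma_replicate` no leading word of
length at least 2 is a power of a letter. Sorting by length and by occurrence of z gives 3 dim V ≤ 2
dim W (`card_le_of_cons_append_mem`).

Both parts of the theorem follow, since a quotient by a subgroup of P_{n+1} has the same n-th layers
as the free group (`exists_fg_rank_layer`). -/

open scoped commutatorElement

/-! ### The ring of noncommutative power series -/

/-- Formal power series over `ℤ` in noncommuting variables indexed by `α`. -/
def NCSeries (α : Type*) := List α → ℤ

namespace NCSeries

variable {α : Type*}

instance : AddCommGroup (NCSeries α) := inferInstanceAs (AddCommGroup (List α → ℤ))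

@[ext] theorem ext {f g : NCSeries α} (h : ∀ w, f w = g w) : f = g := funext h

@[simp] theorem add_apply (f g : NCSeries α) (w : List α) : (f + g) w = f w + g w := rfl
@[simp] theorem sub_apply (f g : NCSeries α) (w : List α) : (f - g) w = f w - g w := rfl
@[simp] theorem neg_apply (f : NCSeries α) (w : List α) : (-f) w = -f w := rfl
@[simp] theorem zero_apply (w : List α) : (0 : NCSeries α) w = 0 := rfl
@[simp] theorem zsmul_apply (c : ℤ) (f : NCSeries α) (w : List α) : (c • f) w = c * f w := rfl
@[simp] theorem nsmul_apply (c : ℕ) (f : NCSeries α) (w : List α) : (c • f) w = c * f w := by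
  rw [← natCast_zsmul, zsmul_apply]

/-- The left shift: the series `f_a` in `f = f [] + ∑ a, X a * f_a`. -/
def shift (a : α) (f : NCSeries α) : NCSeries α := fun w => f (a :: w)

@[simp] theorem shift_apply (a : α) (f : NCSeries α) (w : List α) : shift a f w = f (a :: w) := rfl

/-- The coefficient of `w` in the product of two series. -/
def conv : List α → NCSeries α → NCSeries α → ℤ
  | [], f, g => f [] * g []
  | a :: w, f, g => f [] * g (a :: w) + conv w (shift a f) g

instance : Mul (NCSeries α) := ⟨fun f g w => conv w f g⟩

instance : One (NCSeries α) := ⟨fun w => match w with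
  | [] => 1
  | _ :: _ => 0⟩

@[simp] theorem one_nil : (1 : NCSeries α) [] = 1 := rfl
@[simp] theorem one_cons (a : α) (w : List α) : (1 : NCSeries α) (a :: w) = 0 := rfl

theorem one_of_ne_nil {w : List α} (h : w ≠ []) : (1 : NCSeries α) w = 0 := by
  cases w <;> simp_all

@[simp] theorem mul_nil (f g : NCSeries α) : (f * g) [] = f [] * g [] := rfl

theorem mul_cons (f g : NCSeries α) (a : α) (w : List α) :
    (f * g) (a :: w) = f [] * g (a :: w) + (shift a f * g) w := rfl

theorem shift_add (a : α) (f g : NCSeries α) : shift a (f + g) = shift a f + shift a g := rfl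
theorem shift_zsmul (a : α) (c : ℤ) (f : NCSeries α) : shift a (c • f) = c • shift a f := rfl
theorem shift_zero (a : α) : shift a (0 : NCSeries α) = 0 := rfl
theorem shift_one (a : α) : shift a (1 : NCSeries α) = 0 := rfl

theorem shift_mul (a : α) (f g : NCSeries α) :
    shift a (f * g) = f [] • shift a g + shift a f * g := rfl

protected theorem zero_mul_apply (g : NCSeries α) (w : List α) : (0 * g) w = 0 := by
  induction w with
  | nil => simp
  | cons a w ih => rw [mul_cons, shift_zero, ih]; simp

protected theorem mul_zero_apply (f : NCSeries α) (w : List α) : (f * 0) w = 0 := by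
  induction w generalizing f with
  | nil => simp
  | cons a w ih => rw [mul_cons, ih]; simp

protected theorem add_mul_apply (f g h : NCSeries α) (w : List α) :
    ((f + g) * h) w = (f * h) w + (g * h) w := by
  induction w generalizing f g with
  | nil => simp [_root_.add_mul]
  | cons a w ih => simp only [mul_cons, shift_add, ih, add_apply]; ring

protected theorem mul_add_apply (f g h : NCSeries α) (w : List α) :
    (f * (g + h)) w = (f * g) w + (f * h) w := by
  induction w generalizing f with
  | nil => simp [_root_.mul_add]
  | cons a w ih => simp only [mul_cons, ih, add_apply]; ring

protected theorem zsmul_mul_apply (c : ℤ) (f g : NCSeries α) (w : List α) :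
    ((c • f) * g) w = c * (f * g) w := by
  induction w generalizing f with
  | nil => simp [_root_.mul_assoc]
  | cons a w ih => simp only [mul_cons, shift_zsmul, ih, zsmul_apply]; ring

protected theorem mul_assoc_apply (f g h : NCSeries α) (w : List α) :
    ((f * g) * h) w = (f * (g * h)) w := by
  induction w generalizing f with
  | nil => simp [_root_.mul_assoc]
  | cons a w ih =>
    simp only [mul_cons, shift_mul, NCSeries.add_mul_apply, NCSeries.zsmul_mul_apply, ih, mul_nil]
    ring

protected theorem one_mul_apply (f : NCSeries α) (w : List α) : (1 * f) w = f w := by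
  cases w with
  | nil => simp
  | cons a w => rw [mul_cons, shift_one, NCSeries.zero_mul_apply]; simp

protected theorem mul_one_apply (f : NCSeries α) (w : List α) : (f * 1) w = f w := by
  induction w generalizing f with
  | nil => simp
  | cons a w ih => rw [mul_cons, ih]; simp

instance : Ring (NCSeries α) :=
  { (inferInstance : AddCommGroup (NCSeries α)) with
    zero_mul := fun f => ext fun w => NCSeries.zero_mul_apply f w
    mul_zero := fun f => ext fun w => NCSeries.mul_zero_apply f w
    left_distrib := fun f g h => ext fun w => NCSeries.mul_add_apply f g h w
    right_distrib := fun f g h => ext fun w => NCSeries.add_mul_apply f g h w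
    mul_assoc := fun f g h => ext fun w => NCSeries.mul_assoc_apply f g h w
    one_mul := fun f => ext fun w => NCSeries.one_mul_apply f w
    mul_one := fun f => ext fun w => NCSeries.mul_one_apply f w }

theorem natCast_mul_apply (m : ℕ) (f : NCSeries α) (w : List α) :
    ((m : NCSeries α) * f) w = m * f w := by
  rw [← nsmul_eq_mul, nsmul_apply]

/-! ### The Magnus embedding -/

section Variables

variable [DecidableEq α]

/-- The variable `X a`. -/
def X (a : α) : NCSeries α := fun w => if w = [a] then 1 else 0

theorem shift_X (a b : α) : shift b (X a) = if b = a then 1 else 0 := by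
  ext w
  cases w <;> by_cases h : b = a <;> simp [X, h]

theorem X_mul_cons (a b : α) (f : NCSeries α) (w : List α) :
    (X a * f) (b :: w) = if b = a then f w else 0 := by
  rw [mul_cons, shift_X]
  by_cases h : b = a <;> simp [X, h]

theorem mul_X_concat (a b : α) (f : NCSeries α) (w : List α) :
    (f * X a) (w ++ [b]) = if b = a then f w else 0 := by
  induction w generalizing f with
  | nil =>
    rw [List.nil_append, mul_cons, mul_nil]
    by_cases h : b = a <;> simp [X, h]
  | cons c w ih =>
    rw [List.cons_append, mul_cons, ih]
    simp [X]

/-- The inverse of `1 + X a`. -/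
def oneAddXInv (a : α) : NCSeries α := fun w => if ∀ b ∈ w, b = a then (-1) ^ w.length else 0

theorem oneAddXInv_mul (a : α) : oneAddXInv a * (1 + X a) = 1 := by
  ext w
  rw [mul_add, mul_one, add_apply]
  rcases List.eq_nil_or_concat w with rfl | ⟨w, b, rfl⟩
  · simp [oneAddXInv, X]
  · rw [List.concat_eq_append, mul_X_concat, one_of_ne_nil (by simp)]
    by_cases h : b = a <;> simp only [oneAddXInv, List.forall_mem_append, List.mem_singleton,
      forall_eq, h, and_true, and_false, if_true, if_false, List.length_append, List.length_singleton, pow_succ]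
    · split_ifs <;> ring
    · simp

theorem mul_oneAddXInv (a : α) : (1 + X a) * oneAddXInv a = 1 := by
  ext w
  rw [add_mul, one_mul, add_apply]
  cases w with
  | nil => simp [oneAddXInv, X]
  | cons b w =>
    rw [X_mul_cons, one_cons]
    by_cases h : b = a <;> simp only [oneAddXInv, List.forall_mem_cons, h, true_and, false_and,
      if_true, if_false, List.length_cons, pow_succ]
    · split_ifs <;> ring
    · simp

/-- The unit `1 + X a`. -/
def oneAddX (a : α) : (NCSeries α)ˣ := ⟨1 + X a, oneAddXInv a, mul_oneAddXInv a, oneAddXInv_mul a⟩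

/-- The Magnus embedding of the free group. -/
def magnus : FreeGroup α →* (NCSeries α)ˣ := FreeGroup.lift oneAddX

/-- The Magnus expansion of an element of the free group, without its constant term `1`. -/
def mag (g : FreeGroup α) : NCSeries α := (magnus g : NCSeries α) - 1

theorem magnus_eq (g : FreeGroup α) : (magnus g : NCSeries α) = 1 + mag g := by
  simp [mag]

@[simp] theorem mag_one : mag (1 : FreeGroup α) = 0 := by simp [mag]

@[simp] theorem mag_of (a : α) : mag (FreeGroup.of a) = X a := by
  simp [mag, magnus, oneAddX]

theorem mag_mul (g h : FreeGroup α) : mag (g * h) = mag g + mag h + mag g * mag h := by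
  have : (magnus (g * h) : NCSeries α) = (1 + mag g) * (1 + mag h) := by
    rw [map_mul, Units.val_mul, magnus_eq, magnus_eq]
  rw [mag, this]; noncomm_ring

theorem mag_inv (g : FreeGroup α) : mag g⁻¹ = -mag g - mag g * mag g⁻¹ := by
  have := mag_mul g g⁻¹
  rw [mul_inv_cancel, mag_one] at this
  rw [sub_eq_add_neg, ← neg_add, eq_neg_iff_add_eq_zero, this]
  abel

theorem mag_nil (g : FreeGroup α) : mag g [] = 0 := by
  induction g using FreeGroup.induction_on with
  | C1 => simp
  | of a => simp [X]
  | inv_of a h => rw [mag_inv]; simp [X]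
  | mul g h hg hh => rw [mag_mul]; simp [hg, hh]

/-- From [g, h] - 1 = (gh - hg)(hg)⁻¹, where gh - hg only involves the parts without constant term.
-/
theorem mag_commutator (g h : FreeGroup α) :
    mag ⁅g, h⁆ = (mag g * mag h - mag h * mag g) * (1 + mag (g⁻¹ * h⁻¹)) := by
  have h1 : (magnus ⁅g, h⁆ : NCSeries α) * (magnus (h * g) : NCSeries α) = magnus (g * h) := by
    rw [← Units.val_mul, ← map_mul]; congr 2; simp [commutatorElement_def]
  have h2 : (magnus (h * g) : NCSeries α) * (magnus (g⁻¹ * h⁻¹) : NCSeries α) = 1 := by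
    rw [← Units.val_mul, ← map_mul]; simp [mul_assoc]
  have h3 : (magnus ⁅g, h⁆ : NCSeries α) =
      (magnus (g * h) : NCSeries α) * (magnus (g⁻¹ * h⁻¹) : NCSeries α) := by
    rw [← h1, mul_assoc, h2, mul_one]
  have h4 : mag g * mag h - mag h * mag g =
      (magnus (g * h) : NCSeries α) - (magnus (h * g) : NCSeries α) := by
    rw [magnus_eq, magnus_eq, mag_mul, mag_mul]; noncomm_ring
  rw [h4, ← magnus_eq, sub_mul, h2, ← h3, mag]

/-- Isolates the linear term: the remainder is a multiple of f², which lies deeper in the filtration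
`J` and contains only longer words. -/
theorem exists_one_add_pow {R : Type*} [Ring R] (f : R) (m : ℕ) :
    ∃ h : R, (1 + f) ^ m = 1 + m * f + f * f * h := by
  induction m with
  | zero => exact ⟨0, by simp⟩
  | succ m ih =>
    obtain ⟨h, ih⟩ := ih
    refine ⟨h + h * f + m, ?_⟩
    have hc : (m : R) * (f * f) = f * f * m := Nat.cast_comm m _
    rw [pow_succ, ih, mul_add (f * f), ← hc]
    push_cast
    noncomm_ring

theorem exists_mag_pow (g : FreeGroup α) (m : ℕ) :
    ∃ h : NCSeries α, mag (g ^ m) = m * mag g + mag g * mag g * h := by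
  obtain ⟨h, hh⟩ := exists_one_add_pow (mag g) m
  refine ⟨h, ?_⟩
  rw [mag, map_pow, Units.val_pow_eq_pow_val, magnus_eq, hh]; abel

end Variables

/-! ### The filtration by word length and p-divisibility, and its graded pieces -/

/-- The series whose coefficient at `w` is divisible by `p ^ (n - w.length)`. -/
def J (α : Type*) (p n : ℕ) : AddSubgroup (NCSeries α) where
  carrier := {f | ∀ w, (p : ℤ) ^ (n - w.length) ∣ f w}
  zero_mem' := fun w => by simp
  add_mem' := fun hf hg w => dvd_add (hf w) (hg w)
  neg_mem' := fun hf w => (dvd_neg (α := ℤ)).2 (hf w)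

theorem J_anti {p m n : ℕ} (h : m ≤ n) : J α p n ≤ J α p m := fun _ hf w =>
  (pow_dvd_pow _ (by omega)).trans (hf w)

theorem mem_J_zero (p : ℕ) (f : NCSeries α) : f ∈ J α p 0 := fun w => by simp

/-- For each splitting w = st the exponents satisfy (m - |s|) + (n - |t|) ≥ m + n - |w|, also with
truncated subtraction. -/
theorem mul_mem_J {p m n : ℕ} {f g : NCSeries α} (hf : f ∈ J α p m) (hg : g ∈ J α p n) :
    f * g ∈ J α p (m + n) := by
  intro w
  induction w generalizing f m with
  | nil =>
    rw [mul_nil]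
    have h := mul_dvd_mul (hf []) (hg [])
    rw [← pow_add] at h
    simpa using h
  | cons a w ih =>
    rw [mul_cons]
    refine dvd_add ?_ ?_
    · have h := mul_dvd_mul (hf []) (hg (a :: w))
      rw [← pow_add] at h
      refine (pow_dvd_pow _ ?_).trans h
      simp only [List.length_nil, List.length_cons]
      omega
    · have hs : shift a f ∈ J α p (m - 1) := fun v => by
        have h := hf (a :: v)
        rw [List.length_cons, show m - (v.length + 1) = m - 1 - v.length by omega] at h
        exact h
      refine (pow_dvd_pow _ ?_).trans (ih hs)
      simp only [List.length_cons]
      omega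

theorem mul_mem_J_left {p m : ℕ} {f : NCSeries α} (g : NCSeries α) (hf : f ∈ J α p m) :
    f * g ∈ J α p m := by
  simpa using mul_mem_J hf (mem_J_zero p g)

theorem natCast_mul_mem_J {p m : ℕ} {f : NCSeries α} (hf : f ∈ J α p m) :
    (p : NCSeries α) * f ∈ J α p (m + 1) := by
  intro w
  rw [natCast_mul_apply]
  exact (pow_dvd_pow _ (by omega)).trans ((pow_succ' (p : ℤ) _).dvd.trans
    (mul_dvd_mul_left _ (hf w)))

theorem X_mem_J [DecidableEq α] (p : ℕ) (a : α) : X a ∈ J α p 1 := by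
  intro w
  cases w <;> simp [X]

/-- The coefficients of the class of a series in the quotient of `J α p n` by `J α p (n + 1)`. -/
def symb (p n : ℕ) (f : NCSeries α) : List α → ZMod p := fun w =>
  if w.length ≤ n then ((f w / (p : ℤ) ^ (n - w.length) : ℤ) : ZMod p) else 0

theorem symb_of_lt {p n : ℕ} {f : NCSeries α} {w : List α} (h : n < w.length) :
    symb p n f w = 0 := if_neg (by omega)

theorem symb_add {p n : ℕ} {f g : NCSeries α} (hf : f ∈ J α p n) :
    symb p n (f + g) = symb p n f + symb p n g := by
  funext w
  simp only [symb, Pi.add_apply, add_apply]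
  split_ifs
  · rw [Int.add_ediv_of_dvd_left (hf w), Int.cast_add]
  · simp

theorem symb_apply_of_eq_mul {p n : ℕ} [Fact p.Prime] {f : NCSeries α} {w : List α}
    (h : w.length ≤ n) {c : ℤ} (hc : f w = p ^ (n - w.length) * c) : symb p n f w = c := by
  have hp : (p : ℤ) ^ (n - w.length) ≠ 0 :=
    pow_ne_zero _ (by exact_mod_cast (Fact.out : p.Prime).ne_zero)
  rw [symb, if_pos h, hc, Int.mul_ediv_cancel_left _ hp]

theorem symb_apply_eq_zero_iff {p n : ℕ} [Fact p.Prime] {f : NCSeries α} (hf : f ∈ J α p n)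
    {w : List α} (h : w.length ≤ n) : symb p n f w = 0 ↔ (p : ℤ) ^ (n + 1 - w.length) ∣ f w := by
  have hp : (p : ℤ) ^ (n - w.length) ≠ 0 :=
    pow_ne_zero _ (by exact_mod_cast (Fact.out : p.Prime).ne_zero)
  obtain ⟨c, hc⟩ := hf w
  rw [symb_apply_of_eq_mul h hc, ZMod.intCast_zmod_eq_zero_iff_dvd, hc,
    show n + 1 - w.length = n - w.length + 1 by omega, pow_succ, mul_dvd_mul_iff_left hp]

theorem symb_eq_zero_iff {p n : ℕ} [Fact p.Prime] {f : NCSeries α} (hf : f ∈ J α p n) :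
    symb p n f = 0 ↔ f ∈ J α p (n + 1) := by
  constructor
  · intro h w
    by_cases hw : w.length ≤ n
    · exact (symb_apply_eq_zero_iff hf hw).1 (congrFun h w)
    · simp [show n + 1 - w.length = 0 by omega]
  · intro h
    funext w
    by_cases hw : w.length ≤ n
    · exact (symb_apply_eq_zero_iff hf hw).2 (h w)
    · exact symb_of_lt (by omega)

theorem symb_congr {p n : ℕ} [Fact p.Prime] {f g : NCSeries α} (hg : g ∈ J α p n)
    (h : f - g ∈ J α p (n + 1)) : symb p n f = symb p n g := by
  have h1 := symb_add (g := f - g) hg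
  rw [(symb_eq_zero_iff (J_anti (Nat.le_succ n) h)).2 h] at h1
  simpa using h1

end NCSeries

/-! ### Commutator calculus in the lower p-series -/

section LowerPSeries

variable {H : Type*} [Group H] {p : ℕ}

theorem mk_commute_iff (N : Subgroup H) [N.Normal] (g h : H) :
    Commute (g : H ⧸ N) (h : H ⧸ N) ↔ ⁅g, h⁆ ∈ N := by
  rw [← commutatorElement_eq_one_iff_commute, ← QuotientGroup.eq_one_iff]
  rfl

theorem commutator_pow_left {g h : H} (hc : Commute ⁅g, h⁆ g) (m : ℕ) :
    ⁅g ^ m, h⁆ = ⁅g, h⁆ ^ m := by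
  induction m with
  | zero => simp
  | succ m ih =>
    have h1 : ⁅g ^ (m + 1), h⁆ = g * ⁅g ^ m, h⁆ * g⁻¹ * ⁅g, h⁆ := by
      simp only [commutatorElement_def, pow_succ']; group
    rw [h1, ih, ← (hc.pow_left m).eq, mul_inv_cancel_right, pow_succ]

theorem commutator_mem_symm {N : Subgroup H} {g h : H} (hN : ⁅g, h⁆ ∈ N) : ⁅h, g⁆ ∈ N := by
  rw [← commutatorElement_inv]; exact inv_mem hN

theorem lowerPSeries_succ {n : ℕ} (hn : 1 ≤ n) :
    lowerPSeries p H (n + 1) = powComm p (lowerPSeries p H n) := by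
  obtain ⟨n, rfl⟩ := Nat.exists_eq_add_of_le' hn
  rfl

theorem lowerPSeries_one : lowerPSeries p H 1 = ⊤ := rfl

theorem pow_mem_powComm {K : Subgroup H} {g : H} (hg : g ∈ K) : g ^ p ∈ powComm p K :=
  Subgroup.mem_sup_left (Subgroup.subset_closure ⟨g, hg, rfl⟩)

theorem commutator_mem_powComm {K : Subgroup H} {g : H} (hg : g ∈ K) (h : H) :
    ⁅g, h⁆ ∈ powComm p K :=
  Subgroup.mem_sup_right (Subgroup.commutator_mem_commutator hg (Subgroup.mem_top h))

theorem powComm_le {K N : Subgroup H} (h1 : ∀ g ∈ K, g ^ p ∈ N) (h2 : ∀ g ∈ K, ∀ h, ⁅g, h⁆ ∈ N) :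
    powComm p K ≤ N := by
  refine sup_le ((Subgroup.closure_le _).2 ?_) (Subgroup.commutator_le.2 fun g hg h _ => h2 g hg h)
  rintro _ ⟨x, hx, rfl⟩
  exact h1 x hx

theorem pow_mem_lowerPSeries {n : ℕ} {g : H} (hg : g ∈ lowerPSeries p H n) :
    g ^ p ∈ lowerPSeries p H (n + 1) := by
  cases n with
  | zero => exact Subgroup.mem_top _
  | succ n => exact pow_mem_powComm hg

theorem commutator_mem_lowerPSeries {n : ℕ} {g : H} (hg : g ∈ lowerPSeries p H n) (h : H) :
    ⁅g, h⁆ ∈ lowerPSeries p H (n + 1) := by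
  cases n with
  | zero => exact Subgroup.mem_top _
  | succ n => exact commutator_mem_powComm hg h

theorem lowerPSeries_le {n : ℕ} (hn : 1 ≤ n) {N : Subgroup H}
    (h1 : ∀ g ∈ lowerPSeries p H n, g ^ p ∈ N)
    (h2 : ∀ g ∈ lowerPSeries p H n, ∀ h, ⁅g, h⁆ ∈ N) : lowerPSeries p H (n + 1) ≤ N := by
  rw [lowerPSeries_succ hn]
  exact powComm_le h1 h2

theorem commutator_mem_of_normal {N : Subgroup H} (hN : N.Normal) {g : H} (hg : g ∈ N) (h : H) :
    ⁅g, h⁆ ∈ N := by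
  rw [commutatorElement_def, mul_assoc, mul_assoc]
  refine mul_mem hg ?_
  rw [← mul_assoc]
  exact hN.conj_mem _ (inv_mem hg) h

theorem lowerPSeries_succ_le (n : ℕ) : lowerPSeries p H (n + 1) ≤ lowerPSeries p H n := by
  cases n with
  | zero => exact le_top
  | succ n =>
    exact lowerPSeries_le (by omega) (fun g hg => pow_mem hg p)
      fun g hg h => commutator_mem_of_normal inferInstance hg h

theorem lowerPSeries_anti : Antitone (lowerPSeries p H) := antitone_nat_of_succ_le lowerPSeries_succ_le

theorem pow_pow_mem_lowerPSeries {n : ℕ} {g : H} (hg : g ∈ lowerPSeries p H n) (m : ℕ) :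
    g ^ p ^ m ∈ lowerPSeries p H (n + m) := by
  induction m with
  | zero => simpa using hg
  | succ m ih => rw [pow_succ, pow_mul, ← add_assoc]; exact pow_mem_lowerPSeries ih

/-- P_n / P_{n+1} is central in H / P_{n+1}, so all its subgroups are normal there. -/
theorem normal_of_between {n : ℕ} {N : Subgroup H} (h1 : lowerPSeries p H (n + 1) ≤ N)
    (h2 : N ≤ lowerPSeries p H n) : N.Normal := by
  refine ⟨fun g hg x => ?_⟩
  have : x * g * x⁻¹ = ⁅x, g⁆ * g := by simp [commutatorElement_def]
  rw [this]
  exact mul_mem (h1 (commutator_mem_symm (commutator_mem_lowerPSeries (h2 hg) x))) hg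

/-- Induction on i. Modulo P_{i+1+j}, both kinds of generators of P_{i+1} centralize P_j: p-th
powers because [g^p, h] = [g, h]^p there, commutators by the three subgroups lemma. -/
theorem commutator_lowerPSeries_le {i j : ℕ} (hi : 1 ≤ i) (hj : 1 ≤ j) :
    ⁅lowerPSeries p H i, lowerPSeries p H j⁆ ≤ lowerPSeries p H (i + j) := by
  induction i, hi using Nat.le_induction generalizing j with
  | base =>
    rw [Subgroup.commutator_comm, add_comm, Subgroup.commutator_le]
    exact fun g hg h _ => commutator_mem_lowerPSeries hg h
  | succ i hi ih =>
    set N := lowerPSeries p H (i + 1 + j) with hN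
    have hN' : N = lowerPSeries p H (i + j + 1) := by rw [hN]; congr 1; omega
    let π := QuotientGroup.mk' N
    have hle : lowerPSeries p H (i + 1) ≤
        (Subgroup.centralizer ((lowerPSeries p H j).map π : Set (H ⧸ N))).comap π := by
      refine lowerPSeries_le hi ?_ ?_
      · rintro g hg _ ⟨h, hh, rfl⟩
        have hc := ih hj (Subgroup.commutator_mem_commutator hg hh)
        have h1 : Commute ⁅π g, π h⁆ (π g) := by
          rw [← map_commutatorElement]
          refine (mk_commute_iff N _ _).2 ?_
          rw [hN']
          exact commutator_mem_lowerPSeries hc g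
        have h2 : ⁅π g, π h⁆ ^ p = 1 := by
          rw [← map_commutatorElement, ← map_pow]
          refine (QuotientGroup.eq_one_iff _).2 ?_
          rw [hN']
          exact pow_mem_lowerPSeries hc
        rw [← commutator_pow_left h1, commutatorElement_eq_one_iff_mul_comm, ← map_pow] at h2
        exact h2.symm
      · intro g hg x
        have key : ⁅⁅(lowerPSeries p H i).map π, (⊤ : Subgroup H).map π⁆,
            (lowerPSeries p H j).map π⁆ = ⊥ := by
          apply Subgroup.commutator_commutator_eq_bot_of_rotate
          · rw [← Subgroup.map_commutator, ← Subgroup.map_commutator, Subgroup.map_eq_bot_iff,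
              QuotientGroup.ker_mk']
            refine (Subgroup.commutator_mono (K₁ := lowerPSeries p H (j + 1)) ?_ le_rfl).trans ?_
            · rw [Subgroup.commutator_comm, Subgroup.commutator_le]
              exact fun g hg h _ => commutator_mem_lowerPSeries hg h
            · rw [Subgroup.commutator_comm, hN, show i + 1 + j = i + (j + 1) by omega]
              exact ih (by omega)
          · rw [← Subgroup.map_commutator, ← Subgroup.map_commutator, Subgroup.map_eq_bot_iff,
              QuotientGroup.ker_mk', hN', Subgroup.commutator_le]
            intro g hg h _
            rw [Subgroup.commutator_comm] at hg
            exact commutator_mem_lowerPSeries (ih hj hg) h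
        rw [Subgroup.commutator_eq_bot_iff_le_centralizer] at key
        refine key ?_
        rw [← Subgroup.map_commutator]
        exact Subgroup.mem_map_of_mem _ (Subgroup.commutator_mem_commutator hg (Subgroup.mem_top x))
    rw [Subgroup.commutator_le]
    intro g hg h hh
    refine (mk_commute_iff N _ _).1 ?_
    exact (hle hg _ (Subgroup.mem_map_of_mem π hh)).symm

theorem commutator_mem_lowerPSeries_add {i j k : ℕ} (hi : 1 ≤ i) (hj : 1 ≤ j) (hk : k ≤ i + j)
    {g h : H} (hg : g ∈ lowerPSeries p H i) (hh : h ∈ lowerPSeries p H j) :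
    ⁅g, h⁆ ∈ lowerPSeries p H k :=
  lowerPSeries_anti hk (commutator_lowerPSeries_le hi hj (Subgroup.commutator_mem_commutator hg hh))

theorem commutator_mem_of_closure {N : Subgroup H} [N.Normal] {T : Set H} {h : H}
    (hT : ∀ t ∈ T, ⁅t, h⁆ ∈ N) {g : H} (hg : g ∈ Subgroup.closure T) : ⁅g, h⁆ ∈ N := by
  have : Subgroup.closure T ≤
      (Subgroup.centralizer {(h : H ⧸ N)}).comap (QuotientGroup.mk' N) := by
    rw [Subgroup.closure_le]
    intro t ht
    rw [SetLike.mem_coe, Subgroup.mem_comap, Subgroup.mem_centralizer_singleton_iff]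
    exact ((mk_commute_iff N t h).2 (hT t ht)).eq
  have h1 := this hg
  rw [Subgroup.mem_comap, Subgroup.mem_centralizer_singleton_iff] at h1
  exact (mk_commute_iff N g h).1 h1

/-- Modulo N the closure is commutative, so the m-th power map is multiplicative on it. -/
theorem pow_mem_of_closure {N : Subgroup H} [N.Normal] {T : Set H} (m : ℕ)
    (hc : ∀ x ∈ Subgroup.closure T, ∀ y ∈ Subgroup.closure T, ⁅x, y⁆ ∈ N)
    (hT : ∀ t ∈ T, t ^ m ∈ N) {g : H} (hg : g ∈ Subgroup.closure T) : g ^ m ∈ N := by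
  induction hg using Subgroup.closure_induction with
  | mem x hx => exact hT x hx
  | one => simp
  | mul x y hx hy ihx ihy =>
    have h1 := (mk_commute_iff N x y).2 (hc x hx y hy)
    rw [← QuotientGroup.eq_one_iff] at ihx ihy ⊢
    change (x : H ⧸ N) ^ m = 1 at ihx
    change (y : H ⧸ N) ^ m = 1 at ihy
    change ((x : H ⧸ N) * (y : H ⧸ N)) ^ m = 1
    rw [h1.mul_pow, ihx, ihy, one_mul]
  | inv x _ ih => rw [inv_pow]; exact inv_mem ih

/-- The Jacobi identity modulo a term of the lower `p`-series. -/
theorem commutator_commutator_mem {N : Subgroup H} [N.Normal] {i j l : ℕ} (hi : 1 ≤ i) (hj : 1 ≤ j)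
    (hl : 1 ≤ l) (hN : lowerPSeries p H (i + j + l + 1) ≤ N) {a b c : H}
    (ha : a ∈ lowerPSeries p H i) (hb : b ∈ lowerPSeries p H j) (hc : c ∈ lowerPSeries p H l)
    (h1 : ⁅⁅c, a⁆, b⁆ ∈ N) (h2 : ⁅a, ⁅c, b⁆⁆ ∈ N) : ⁅c, ⁅a, b⁆⁆ ∈ N := by
  have hca : ⁅c, a⁆ ∈ lowerPSeries p H (l + i) := commutator_mem_lowerPSeries_add hl hi le_rfl hc ha
  have hcb : ⁅c, b⁆ ∈ lowerPSeries p H (l + j) := commutator_mem_lowerPSeries_add hl hj le_rfl hc hb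
  have hab : ⁅a, b⁆ ∈ lowerPSeries p H (i + j) := commutator_mem_lowerPSeries_add hi hj le_rfl ha hb
  have e1 := (mk_commute_iff N _ _).2 h1
  have e2 := (mk_commute_iff N _ _).2 h2
  have e3 := (mk_commute_iff N _ _).2
    (hN (commutator_mem_lowerPSeries_add (by omega) (by omega) (by omega) hca hcb))
  have e4 := (mk_commute_iff N _ _).2
    (hN (commutator_mem_lowerPSeries_add (by omega) (by omega) (by omega) hca hab))
  have e5 := (mk_commute_iff N _ _).2
    (hN (commutator_mem_lowerPSeries_add (by omega) (by omega) (by omega) hcb hab))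
  refine (mk_commute_iff N _ _).1 ?_
  -- Conjugation by c sends a to [c, a]a and b to [c, b]b; the commutation relations e1 to e5 then
  -- remove both extra factors, so c commutes with [a, b].
  have f1 : (c : H ⧸ N) * ⁅(a : H ⧸ N), (b : H ⧸ N)⁆ * (c : H ⧸ N)⁻¹ =
      ⁅⁅(c : H ⧸ N), (a : H ⧸ N)⁆ * (a : H ⧸ N), ⁅(c : H ⧸ N), (b : H ⧸ N)⁆ * (b : H ⧸ N)⁆ := by
    simp only [commutatorElement_def]; group
  change Commute ⁅(c : H ⧸ N), (a : H ⧸ N)⁆ (b : H ⧸ N) at e1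
  change Commute (a : H ⧸ N) ⁅(c : H ⧸ N), (b : H ⧸ N)⁆ at e2
  change Commute ⁅(c : H ⧸ N), (a : H ⧸ N)⁆ ⁅(c : H ⧸ N), (b : H ⧸ N)⁆ at e3
  change Commute ⁅(c : H ⧸ N), (a : H ⧸ N)⁆ ⁅(a : H ⧸ N), (b : H ⧸ N)⁆ at e4
  change Commute ⁅(c : H ⧸ N), (b : H ⧸ N)⁆ ⁅(a : H ⧸ N), (b : H ⧸ N)⁆ at e5
  change Commute (c : H ⧸ N) ⁅(a : H ⧸ N), (b : H ⧸ N)⁆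
  generalize ⁅(c : H ⧸ N), (a : H ⧸ N)⁆ = x at *
  generalize ⁅(c : H ⧸ N), (b : H ⧸ N)⁆ = y at *
  generalize (a : H ⧸ N) = a' at *
  generalize (b : H ⧸ N) = b' at *
  have f2 : ⁅x * a', y * b'⁆ = ⁅a', b'⁆ := by
    calc ⁅x * a', y * b'⁆ = x * (a' * y) * b' * a'⁻¹ * (x⁻¹ * b'⁻¹) * y⁻¹ := by
          simp only [commutatorElement_def]; group
      _ = x * (y * a') * b' * a'⁻¹ * (b'⁻¹ * x⁻¹) * y⁻¹ := by rw [e2.eq, e1.inv_inv.eq]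
      _ = x * (y * ⁅a', b'⁆) * x⁻¹ * y⁻¹ := by simp only [commutatorElement_def]; group
      _ = (x * ⁅a', b'⁆) * (y * x⁻¹) * y⁻¹ := by rw [e5.eq]; group
      _ = ⁅a', b'⁆ := by rw [e4.eq, ← e3.inv_left.eq]; group
  rw [f2, mul_inv_eq_iff_eq_mul] at f1
  exact f1

end LowerPSeries

/-! ### Bracketed commutators -/

section LTree

variable {α : Type*}

/-- Binary trees with leaves labelled by letters. -/
inductive LTree (α : Type*)
  | leaf (a : α) : LTree α
  | node (l r : LTree α) : LTree α

namespace LTree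

/-- The word spelled by the leaves of a tree. -/
def word : LTree α → List α
  | leaf a => [a]
  | node l r => word l ++ word r

/-- The number of leaves of a tree. -/
abbrev weight (t : LTree α) : ℕ := t.word.length

theorem word_ne_nil (t : LTree α) : t.word ≠ [] := by
  induction t with
  | leaf a => simp [word]
  | node l r ihl _ => simp [word, ihl]

theorem weight_pos (t : LTree α) : 1 ≤ t.weight := List.length_pos_iff.2 t.word_ne_nil

theorem weight_node (l r : LTree α) : (node l r).weight = l.weight + r.weight := by
  simp [weight, word]

/-- The group commutator with the bracketing given by a tree. -/
def comm : LTree α → FreeGroup α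
  | leaf a => FreeGroup.of a
  | node l r => ⁅comm l, comm r⁆

theorem comm_mem (p : ℕ) (t : LTree α) : t.comm ∈ lowerPSeries p (FreeGroup α) t.weight := by
  induction t with
  | leaf a => exact Subgroup.mem_top _
  | node l r ihl ihr =>
    rw [weight_node]
    exact commutator_mem_lowerPSeries_add l.weight_pos r.weight_pos le_rfl ihl ihr

/-- The power of the commutator of a tree that lies in the `n`-th term of the lower `p`-series. -/
def commPow (p n : ℕ) (t : LTree α) : FreeGroup α := t.comm ^ p ^ (n - t.weight)

theorem commPow_mem {p n : ℕ} {t : LTree α} (h : t.weight ≤ n) :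
    t.commPow p n ∈ lowerPSeries p (FreeGroup α) n := by
  have := pow_pow_mem_lowerPSeries (t.comm_mem p) (n - t.weight)
  rwa [Nat.add_sub_cancel' h] at this

theorem commPow_pow {p n : ℕ} {t : LTree α} (h : t.weight ≤ n) :
    t.commPow p n ^ p = t.commPow p (n + 1) := by
  rw [commPow, commPow, ← pow_mul, ← pow_succ, Nat.sub_add_comm h]

end LTree

end LTree

/-! ### Lyndon words and Hall trees -/

section Lyndon

variable {α : Type*} [LinearOrder α]

theorem append_lt_append_of_not_prefix {u v : List α} (h : u < v) (hp : ∀ t, v ≠ u ++ t)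
    (x y : List α) : u ++ x < v ++ y := by
  induction u generalizing v with
  | nil => exact absurd rfl (hp v)
  | cons a u ih =>
    cases v with
    | nil => simp at h
    | cons b v =>
      rw [List.cons_append, List.cons_append, List.cons_lt_cons_iff]
      rcases List.cons_lt_cons_iff.1 h with h | ⟨rfl, hlt⟩
      · exact Or.inl h
      · exact Or.inr ⟨rfl, ih hlt fun t ht => hp t (by rw [ht, List.cons_append])⟩

theorem append_lt_append_of_length_le {u v : List α} (h : u < v) (hl : v.length ≤ u.length)
    (x y : List α) : u ++ x < v ++ y := by
  refine append_lt_append_of_not_prefix h ?_ x y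
  rintro t rfl
  have : t = [] := by
    rw [List.length_append] at hl
    exact List.length_eq_zero_iff.1 (by omega)
  simp [this] at h

theorem lt_append_of_ne_nil (u : List α) {t : List α} (ht : t ≠ []) : u < u ++ t := by
  have h : u ++ [] < u ++ t := List.append_left_lt (by cases t <;> simp_all)
  simpa using h

/-- A word is Lyndon if it is nonempty and smaller than each of its proper nonempty suffixes. -/
def IsLyndon (w : List α) : Prop :=
  w ≠ [] ∧ ∀ s t, w = s ++ t → s ≠ [] → t ≠ [] → w < t

/-- If v = ut, then v < t because v is Lyndon, hence uv < ut = v. Otherwise u and v differ at a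
position inside both, and appending does not matter. -/
theorem IsLyndon.append_lt {u v : List α} (hu : IsLyndon u) (hv : IsLyndon v) (h : u < v) :
    u ++ v < v := by
  by_cases hp : ∃ t, v = u ++ t
  · obtain ⟨t, ht⟩ := hp
    have htn : t ≠ [] := by rintro rfl; simp [ht] at h
    have h1 := hv.2 u t ht hu.1 htn
    calc u ++ v < u ++ t := List.append_left_lt h1
      _ = v := ht.symm
  · push Not at hp
    simpa using append_lt_append_of_not_prefix h hp v []

theorem IsLyndon.append {u v : List α} (hu : IsLyndon u) (hv : IsLyndon v) (h : u < v) :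
    IsLyndon (u ++ v) := by
  refine ⟨by simp [hu.1], fun s t hst hs ht => ?_⟩
  have huv := hu.append_lt hv h
  rcases List.append_eq_append_iff.1 hst with ⟨a, rfl, ha⟩ | ⟨c, hc, rfl⟩
  · rcases eq_or_ne a [] with rfl | hane
    · rw [List.nil_append] at ha; exact ha ▸ huv
    · exact huv.trans (hv.2 a t ha hane ht)
  · rcases eq_or_ne c [] with rfl | hcne
    · simpa using huv
    · refine append_lt_append_of_length_le (hu.2 s c hc hs hcne) ?_ _ _
      rw [hc, List.length_append]; omega

namespace LTree

/-- A leaf, or a node whose right subtree spells a word that is at least `v`. -/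
def RightGE : LTree α → List α → Prop
  | leaf _, _ => True
  | node _ b, v => v ≤ b.word

/-- Hall trees for the order of words: the standard bracketings of Lyndon words. -/
def IsHall : LTree α → Prop
  | leaf _ => True
  | node l r => IsHall l ∧ IsHall r ∧ l.word < r.word ∧ l.RightGE r.word

theorem IsHall.isLyndon {t : LTree α} (ht : t.IsHall) : IsLyndon t.word := by
  induction t with
  | leaf a =>
    refine ⟨by simp [word], fun s t h hs ht => ?_⟩
    have h1 := congrArg List.length h
    have := List.length_pos_iff.2 hs
    have := List.length_pos_iff.2 ht
    simp [word] at h1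
    omega
  | node l r ihl ihr => exact (ihl ht.1).append (ihr ht.2.1) ht.2.2.1

/-- The right factor is the least proper suffix: the condition `RightGE` carries this from the left
subtree to the whole tree. Hence the word determines where the root splits it, and so the entire
tree. -/
theorem IsHall.word_right_le {l r : LTree α} (h : (node l r).IsHall) {s t : List α}
    (hst : (node l r).word = s ++ t) (hs : s ≠ []) (ht : t ≠ []) : r.word ≤ t := by
  induction l generalizing r s t with
  | leaf a =>
    rcases List.append_eq_append_iff.1 hst with ⟨c, _, hc⟩ | ⟨c, hc, rfl⟩
    · rcases eq_or_ne c [] with rfl | hcne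
      · rw [hc]; rfl
      · exact (h.2.1.isLyndon.2 c t hc hcne ht).le
    · have h1 := congrArg List.length hc
      have := List.length_pos_iff.2 hs
      have hcn : c = [] := List.length_eq_zero_iff.1 (by simp [word] at h1; omega)
      simp [hcn]
  | node l' b ih _ =>
    rcases List.append_eq_append_iff.1 hst with ⟨c, _, hc⟩ | ⟨c, hc, rfl⟩
    · rcases eq_or_ne c [] with rfl | hcne
      · rw [hc]; rfl
      · exact (h.2.1.isLyndon.2 c t hc hcne ht).le
    · rcases eq_or_ne c [] with rfl | hcne
      · simp
      · have h1 : b.word ≤ c := ih h.1 hc hs hcne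
        have h2 : r.word ≤ b.word := h.2.2.2
        exact (h2.trans h1).trans (lt_append_of_ne_nil c r.word_ne_nil).le

theorem IsHall.word_injective {t t' : LTree α} (ht : t.IsHall) (ht' : t'.IsHall)
    (h : t.word = t'.word) : t = t' := by
  induction t generalizing t' with
  | leaf a =>
    cases t' with
    | leaf b => simpa [word] using h
    | node l r =>
      have h1 := congrArg List.length h
      have := l.weight_pos
      have := r.weight_pos
      simp only [word, List.length_append, List.length_singleton, weight] at *
      omega
  | node l r ihl ihr =>
    cases t' with
    | leaf b =>
      have h1 := congrArg List.length h
      have := l.weight_pos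
      have := r.weight_pos
      simp only [word, List.length_append, List.length_singleton, weight] at *
      omega
    | node l' r' =>
      have h1 : r.word = r'.word := le_antisymm
        (ht.word_right_le h l'.word_ne_nil r'.word_ne_nil)
        (ht'.word_right_le h.symm l.word_ne_nil r.word_ne_nil)
      have h2 : l.word = l'.word := by
        simp only [word, h1] at h
        exact List.append_cancel_right h
      rw [ihl ht.1 ht'.1 h2, ihr ht.2.1 ht'.2.1 h1]

theorem finite_isHall_weight_le [Finite α] (n : ℕ) :
    {t : LTree α | t.IsHall ∧ t.weight ≤ n}.Finite := by
  refine Set.Finite.of_injOn (f := word) (t := {w : List α | w.length ≤ n}) (fun t ht => ht.2) ?_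
    (List.finite_length_le α n)
  exact fun t ht t' ht' h => ht.1.word_injective ht'.1 h

/-! ### Generation of the layers by powers of Hall commutators -/

/-- The subgroup generated by the next term of the lower `p`-series and the commutators of those
Hall trees of weight `k` whose word satisfies `P`. -/
def hallSpan (p k : ℕ) (P : List α → Prop) : Subgroup (FreeGroup α) :=
  Subgroup.closure ({g | ∃ t : LTree α, t.IsHall ∧ t.weight = k ∧ P t.word ∧ t.comm = g} ∪
    lowerPSeries p (FreeGroup α) (k + 1))

theorem comm_mem_hallSpan (p : ℕ) {k : ℕ} {P : List α → Prop} {t : LTree α} (h : t.IsHall)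
    (hk : t.weight = k) (hP : P t.word) : t.comm ∈ hallSpan p k P :=
  Subgroup.subset_closure (Or.inl ⟨t, h, hk, hP, rfl⟩)

theorem lowerPSeries_le_hallSpan (p k : ℕ) (P : List α → Prop) :
    lowerPSeries p (FreeGroup α) (k + 1) ≤ hallSpan p k P :=
  fun _ hg => Subgroup.subset_closure (Or.inr hg)

theorem hallSpan_le (p k : ℕ) (P : List α → Prop) :
    hallSpan p k P ≤ lowerPSeries p (FreeGroup α) k := by
  refine (Subgroup.closure_le _).2 (Set.union_subset ?_ (lowerPSeries_succ_le k))
  rintro _ ⟨t, _, rfl, _, rfl⟩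
  exact t.comm_mem p

instance hallSpan_normal (p k : ℕ) (P : List α → Prop) : (hallSpan p k P).Normal :=
  normal_of_between (lowerPSeries_le_hallSpan p k P) (hallSpan_le p k P)

theorem hallSpan_mono (p k : ℕ) {P Q : List α → Prop} (h : ∀ w, P w → Q w) :
    hallSpan p k P ≤ hallSpan p k Q := by
  refine Subgroup.closure_mono (Set.union_subset_union_left _ ?_)
  rintro _ ⟨t, h1, h2, h3, rfl⟩
  exact ⟨t, h1, h2, h _ h3, rfl⟩

/-- Commutators with an element of weight `j` map the span in weight `i` to `N`, if they do so for
the spanning elements. -/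
theorem commutator_mem_of_mem_hallSpan {p i j : ℕ} (hj : 1 ≤ j) {P : List α → Prop}
    {N : Subgroup (FreeGroup α)} [N.Normal] (hN : lowerPSeries p (FreeGroup α) (i + j + 1) ≤ N)
    {h : FreeGroup α} (hh : h ∈ lowerPSeries p (FreeGroup α) j)
    (H : ∀ t : LTree α, t.IsHall → t.weight = i → P t.word → ⁅t.comm, h⁆ ∈ N)
    {g : FreeGroup α} (hg : g ∈ hallSpan p i P) : ⁅g, h⁆ ∈ N := by
  refine commutator_mem_of_closure ?_ hg
  rintro _ (⟨t, h1, h2, h3, rfl⟩ | ht)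
  · exact H t h1 h2 h3
  · exact hN (commutator_mem_lowerPSeries_add (by omega) hj (by omega) ht hh)

/-- The rewriting step of Hall's collection. If the node of u and v is not a Hall tree, then u = [a,
b] with b < v, and the Jacobi identity reduces to [[v, a], b] and [a, [v, b]]. The inner commutators
have smaller weight and expand into trees with words below v. What remains are commutators of two
trees below v. The bound by v in the conclusion is what makes this induction run. -/
theorem commutator_comm_mem_hallSpan_of_lt [Finite α] (p k : ℕ) (u v : LTree α) (hu : u.IsHall)
    (hv : v.IsHall) (hk : u.weight + v.weight = k) (huv : u.word < v.word) :
    ⁅u.comm, v.comm⁆ ∈ hallSpan p k (· < v.word) := by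
  induction k using Nat.strong_induction_on generalizing u v with
  | _ k ihk =>
  have hfin (w : List α) : {w' : List α | w'.length ≤ k ∧ w' < w}.Finite :=
    (List.finite_length_le α k).subset fun _ h => h.1
  -- The lexicographic order on all words is not well-founded; counting the words below v of length
  -- at most k provides a measure.
  induction hm : {w : List α | w.length ≤ k ∧ w < v.word}.ncard using Nat.strong_induction_on
    generalizing u v with
  | _ m ihm =>
  have hpair : ∀ t₁ t₂ : LTree α, t₁.IsHall → t₂.IsHall → t₁.weight + t₂.weight = k →
      t₁.word < v.word → t₂.word < v.word → ⁅t₁.comm, t₂.comm⁆ ∈ hallSpan p k (· < v.word) := by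
    have hlt : ∀ t₁ t₂ : LTree α, t₁.IsHall → t₂.IsHall → t₁.weight + t₂.weight = k →
        t₂.word < v.word → t₁.word < t₂.word →
        ⁅t₁.comm, t₂.comm⁆ ∈ hallSpan p k (· < v.word) := by
      intro t₁ t₂ h₁ h₂ hw h2v h12
      refine hallSpan_mono p k (fun w hw => lt_trans hw h2v) (ihm _ ?_ t₁ t₂ h₁ h₂ hw h12 rfl)
      rw [← hm]
      refine Set.ncard_lt_ncard ⟨fun w hw => ⟨hw.1, hw.2.trans h2v⟩, fun hsub => ?_⟩ (hfin _)
      exact lt_irrefl _ (hsub (show t₂.word ∈ _ from ⟨by change t₂.weight ≤ k; omega, h2v⟩)).2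
    intro t₁ t₂ h₁ h₂ hw h1v h2v
    rcases lt_trichotomy t₁.word t₂.word with h | h | h
    · exact hlt t₁ t₂ h₁ h₂ hw h2v h
    · rw [h₁.word_injective h₂ h, commutatorElement_self]; exact one_mem _
    · exact commutator_mem_symm (hlt t₂ t₁ h₂ h₁ (by omega) h1v h)
  have hnode (hr : u.RightGE v.word) : ⁅u.comm, v.comm⁆ ∈ hallSpan p k (· < v.word) :=
    comm_mem_hallSpan p (t := node u v) ⟨hu, hv, huv, hr⟩ (by rw [weight_node, hk])
      (hu.isLyndon.append_lt hv.isLyndon huv)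
  cases u with
  | leaf a => exact hnode trivial
  | node a b =>
    rcases le_or_gt v.word b.word with hbv | hbv
    · exact hnode hbv
    -- Here b < v, so the Jacobi identity applies.
    · rw [weight_node] at hk
      have ha1 := a.weight_pos
      have hb1 := b.weight_pos
      have hv1 := v.weight_pos
      have hav : a.word < v.word := hu.2.2.1.trans hbv
      have hle : lowerPSeries p (FreeGroup α) (a.weight + b.weight + v.weight + 1) ≤
          hallSpan p k (· < v.word) := by
        rw [hk]; exact lowerPSeries_le_hallSpan p k _
      refine commutator_mem_symm (commutator_commutator_mem ha1 hb1 hv1 hle (a.comm_mem p)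
        (b.comm_mem p) (v.comm_mem p) ?_ ?_)
      · refine commutator_mem_of_mem_hallSpan hb1 (i := a.weight + v.weight)
          ((lowerPSeries_anti (by omega)).trans hle)
          (b.comm_mem p) ?_ (commutator_mem_symm (ihk _ (by omega) a v hu.1 hv rfl hav))
        intro t ht htw htv
        exact hpair t b ht hu.2.1 (by omega) htv hbv
      · refine commutator_mem_symm (commutator_mem_of_mem_hallSpan ha1 (i := b.weight + v.weight)
          ((lowerPSeries_anti (by omega)).trans hle)
          (a.comm_mem p) ?_ (commutator_mem_symm (ihk _ (by omega) b v hu.2.1 hv rfl hbv)))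
        intro t ht htw htv
        exact hpair t a ht hu.1 (by omega) htv hav

theorem commutator_comm_mem_hallSpan [Finite α] (p : ℕ) {k : ℕ} {u v : LTree α} (hu : u.IsHall)
    (hv : v.IsHall) (hk : u.weight + v.weight = k) :
    ⁅u.comm, v.comm⁆ ∈ hallSpan p k (fun _ => True) := by
  rcases lt_trichotomy u.word v.word with h | h | h
  · exact hallSpan_mono p k (fun _ _ => trivial)
      (commutator_comm_mem_hallSpan_of_lt p k u v hu hv hk h)
  · rw [hu.word_injective hv h, commutatorElement_self]; exact one_mem _
  · exact commutator_mem_symm (hallSpan_mono p k (fun _ _ => trivial)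
      (commutator_comm_mem_hallSpan_of_lt p k v u hv hu (by omega) h))

/-- The powers of Hall commutators that generate the `n`-th term modulo the next one. -/
def powSet (α : Type*) [LinearOrder α] (p n : ℕ) : Set (FreeGroup α) :=
  {g | ∃ t : LTree α, t.IsHall ∧ t.weight ≤ n ∧ t.commPow p n = g}

/-- The subgroup generated by `powSet α p n` and the next term of the lower `p`-series. -/
def powSpan (α : Type*) [LinearOrder α] (p n : ℕ) : Subgroup (FreeGroup α) :=
  Subgroup.closure (powSet α p n ∪ lowerPSeries p (FreeGroup α) (n + 1))

theorem lowerPSeries_succ_le_powSpan (p n : ℕ) : lowerPSeries p (FreeGroup α) (n + 1) ≤ powSpan α p n :=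
  fun _ hg => Subgroup.subset_closure (Or.inr hg)

theorem commPow_mem_powSpan {p n : ℕ} {t : LTree α} (ht : t.IsHall) (h : t.weight ≤ n) :
    t.commPow p n ∈ powSpan α p n := Subgroup.subset_closure (Or.inl ⟨t, ht, h, rfl⟩)

theorem powSpan_le (p n : ℕ) : powSpan α p n ≤ lowerPSeries p (FreeGroup α) n := by
  refine (Subgroup.closure_le _).2 (Set.union_subset ?_ (lowerPSeries_succ_le n))
  rintro _ ⟨t, _, h, rfl⟩
  exact commPow_mem h

instance powSpan_normal (p n : ℕ) : (powSpan α p n).Normal :=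
  normal_of_between (lowerPSeries_succ_le_powSpan p n) (powSpan_le p n)

theorem hallSpan_le_powSpan (p n : ℕ) (P : List α → Prop) : hallSpan p n P ≤ powSpan α p n := by
  refine Subgroup.closure_mono (Set.union_subset_union_left _ ?_)
  rintro _ ⟨t, h1, rfl, _, rfl⟩
  exact ⟨t, h1, le_rfl, by simp [commPow]⟩

/-- The p-th power map is multiplicative on P_n modulo the next span, and it turns the generators of
one degree into those of the next. -/
theorem pow_mem_powSpan {p n : ℕ} (h : lowerPSeries p (FreeGroup α) n ≤ powSpan α p n)
    (hc : ∀ x ∈ lowerPSeries p (FreeGroup α) n, ∀ y ∈ lowerPSeries p (FreeGroup α) n,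
      ⁅x, y⁆ ∈ powSpan α p (n + 1)) {g : FreeGroup α} (hg : g ∈ lowerPSeries p (FreeGroup α) n) :
    g ^ p ∈ powSpan α p (n + 1) := by
  refine pow_mem_of_closure p (fun x hx y hy => hc x (powSpan_le p n hx) y (powSpan_le p n hy))
    ?_ (h hg)
  rintro _ (⟨t, ht, hw, rfl⟩ | ht)
  · rw [commPow_pow hw]
    exact commPow_mem_powSpan ht (by omega)
  · exact lowerPSeries_succ_le_powSpan p _ (pow_mem_lowerPSeries ht)

theorem commutator_commutator_comm_mem [Finite α] {p : ℕ} {t u : LTree α} (ht : t.IsHall)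
    (hu : u.IsHall) (ht1 : t.weight = 1) (hu1 : u.weight = 1) :
    ⁅⁅t.comm, u.comm⁆, t.comm⁆ ∈ powSpan α p 3 := by
  have h1 : ⁅t.comm, u.comm⁆ ∈ hallSpan p 2 fun _ => True :=
    commutator_comm_mem_hallSpan p ht hu (by omega)
  have h2 : t.comm ∈ lowerPSeries p (FreeGroup α) 1 := Subgroup.mem_top _
  have h3 : lowerPSeries p (FreeGroup α) (2 + 1 + 1) ≤ powSpan α p 3 := lowerPSeries_succ_le_powSpan p 3
  refine commutator_mem_of_mem_hallSpan le_rfl h3 h2 ?_ h1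
  intro s hs hs2 _
  exact hallSpan_le_powSpan p 3 _ (commutator_comm_mem_hallSpan p hs ht (by omega))

/-- If t has weight n, this is the rewriting of Hall commutators. Otherwise the element is a p-th
power g^p, and [g^p, a] = [g, a]^p as soon as [[g, a], g] vanishes modulo the target. -/
theorem commutator_commPow_mem [Finite α] {p n : ℕ} (hn : 1 ≤ n)
    (h : lowerPSeries p (FreeGroup α) n ≤ powSpan α p n) {t : LTree α} (ht : t.IsHall)
    (hw : t.weight ≤ n) (a : α) : ⁅t.commPow p n, FreeGroup.of a⁆ ∈ powSpan α p (n + 1) := by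
  have hla : (leaf a).IsHall := trivial
  rcases hw.eq_or_lt with hw | hw
  · have h1 := commutator_comm_mem_hallSpan p (k := n + 1) ht hla (by rw [hw]; rfl)
    have h2 : t.commPow p n = t.comm := by simp [commPow, hw]
    rw [h2]
    exact hallSpan_le_powSpan p (n + 1) _ h1
  · obtain ⟨n, rfl⟩ := Nat.exists_eq_add_of_le' hn
    have ht1 := t.weight_pos
    have hg := commPow_mem (p := p) (show t.weight ≤ n by omega)
    have hle := lowerPSeries_succ_le_powSpan (α := α) p (n + 1 + 1)
    rw [← commPow_pow (by omega)]
    generalize hgdef : t.commPow p n = g at hg ⊢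
    have hcn := commutator_mem_lowerPSeries hg (FreeGroup.of a)
    -- With g in P_n, the double commutator lies in P_{2n+1}, which is deep enough for n ≥ 2. For n
    -- = 1 it only lies in P_3, but there g has weight 1 and Hall rewriting applies.
    have hcg : ⁅⁅g, FreeGroup.of a⁆, g⁆ ∈ powSpan α p (n + 1 + 1) := by
      rcases Nat.lt_or_ge n 2 with hn2 | hn2
      · obtain rfl : n = 1 := by omega
        have hg1 : g = t.comm := by
          rw [← hgdef, commPow, show 1 - t.weight = 0 by omega, pow_zero, pow_one]
        rw [hg1]
        have h1 : t.weight = 1 := by omega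
        exact commutator_commutator_comm_mem (u := leaf a) ht hla h1 rfl
      · have h1 : 1 ≤ n := by omega
        have h2 : n + 1 + 1 + 1 ≤ n + 1 + n := by omega
        have h3 := commutator_mem_lowerPSeries_add (Nat.le_add_left 1 n) h1 h2 hcn hg
        exact hle h3
    have h1 := (mk_commute_iff (powSpan α p (n + 1 + 1)) _ _).2 hcg
    have h2 := commutator_pow_left (g := (g : FreeGroup α ⧸ powSpan α p (n + 1 + 1)))
      (h := (FreeGroup.of a : FreeGroup α)) h1 p
    have h3 : ⁅g, FreeGroup.of a⁆ ^ p ∈ powSpan α p (n + 1 + 1) :=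
      pow_mem_powSpan h (fun x hx y hy => hle
        (commutator_mem_lowerPSeries_add (by omega) (by omega) (by omega) hx hy)) hcn
    rw [← QuotientGroup.eq_one_iff] at h3 ⊢
    exact h2.trans h3

theorem lowerPSeries_le_powSpan [Finite α] (p : ℕ) {n : ℕ} (hn : 1 ≤ n) :
    lowerPSeries p (FreeGroup α) n ≤ powSpan α p n := by
  induction n, hn using Nat.le_induction with
  | base =>
    rw [lowerPSeries_one, ← FreeGroup.closure_range_of, Subgroup.closure_le]
    rintro _ ⟨a, rfl⟩
    have := commPow_mem_powSpan (p := p) (n := 1) (t := leaf a) trivial le_rfl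
    rwa [commPow, show 1 - (leaf a).weight = 0 from rfl, pow_zero, pow_one] at this
  | succ n hn ih =>
    have hcen : ∀ g ∈ lowerPSeries p (FreeGroup α) n, ∀ x, ⁅g, x⁆ ∈ powSpan α p (n + 1) := by
      intro g hg x
      have hx : x ∈ Subgroup.closure (Set.range (FreeGroup.of : α → FreeGroup α)) := by
        rw [FreeGroup.closure_range_of]; trivial
      refine commutator_mem_symm (commutator_mem_of_closure ?_ hx)
      rintro _ ⟨a, rfl⟩
      refine commutator_mem_symm (commutator_mem_of_closure ?_ (ih hg))
      rintro _ (⟨t, ht, hw, rfl⟩ | ht)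
      · exact commutator_commPow_mem hn ih ht hw a
      · exact lowerPSeries_succ_le_powSpan p _ (commutator_mem_lowerPSeries ht _)
    exact lowerPSeries_le hn (fun g hg => pow_mem_powSpan ih (fun x hx y _ => hcen x hx y) hg) hcen

end LTree

end Lyndon

/-! ### Leading words of Magnus expansions -/

namespace NCSeries

variable {α : Type*}

theorem mul_apply_eq_zero {f g : NCSeries α} {w : List α}
    (h : ∀ s t, w = s ++ t → f s * g t = 0) : (f * g) w = 0 := by
  induction w generalizing f with
  | nil => exact h [] [] rfl
  | cons a w ih =>
    rw [mul_cons, h [] (a :: w) rfl, ih fun s t hst => ?_, add_zero]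
    exact h (a :: s) t (by rw [hst, List.cons_append])

theorem mul_apply_append {f g : NCSeries α} {u v : List α}
    (h : ∀ s t, u ++ v = s ++ t → s ≠ u → f s * g t = 0) : (f * g) (u ++ v) = f u * g v := by
  induction u generalizing f with
  | nil =>
    cases v with
    | nil => simp
    | cons a v =>
      rw [List.nil_append, mul_cons, mul_apply_eq_zero, add_zero]
      intro s t hst
      exact h (a :: s) t (by rw [hst]; rfl) (by simp)
  | cons a u ih =>
    rw [List.cons_append, mul_cons, h [] (a :: (u ++ v)) rfl (by simp), zero_add, ih]
    · rfl
    · intro s t hst hs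
      exact h (a :: s) t (by rw [List.cons_append, hst]; rfl) (by simpa using hs)

theorem mul_replicate_congr {f f' g g' : NCSeries α} {c : α}
    (hf : ∀ k, f (List.replicate k c) = f' (List.replicate k c))
    (hg : ∀ k, g (List.replicate k c) = g' (List.replicate k c)) (k : ℕ) :
    (f * g) (List.replicate k c) = (f' * g') (List.replicate k c) := by
  induction k generalizing f f' with
  | zero => simpa using congrArg₂ (· * ·) (hf 0) (hg 0)
  | succ k ih =>
    rw [List.replicate_succ, mul_cons, mul_cons, ← List.replicate_succ, hg (k + 1), ih (f' := shift c f')]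
    · congr 2; exact hf 0
    · exact fun k => hf (k + 1)

theorem symb_natCast_mul {p : ℕ} [Fact p.Prime] {n : ℕ} {f : NCSeries α} (hf : f ∈ J α p n) :
    symb p (n + 1) ((p : NCSeries α) * f) = symb p n f := by
  funext w
  rcases lt_trichotomy w.length (n + 1) with h | h | h
  · obtain ⟨c, hc⟩ := hf w
    rw [symb_apply_of_eq_mul (by omega) hc, symb_apply_of_eq_mul h.le]
    rw [natCast_mul_apply, hc, show n + 1 - w.length = n - w.length + 1 by omega, pow_succ]
    ring
  -- A word of length n + 1 has coefficient p · f w with no power of p to divide by, hence the value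
  -- 0.
  · rw [symb_of_lt (n := n) (by omega), symb, if_pos h.le, natCast_mul_apply, h]
    simp
  · rw [symb_of_lt h, symb_of_lt (by omega)]

section Lead

variable [LinearOrder α]

/-- Every word in `f` is at least `u`, for the order by length and then by the lexicographic order,
and `u` has the coefficient `c`. -/
def MinLead (f : NCSeries α) (u : List α) (c : ℤ) : Prop :=
  (∀ w, f w ≠ 0 → u.length < w.length ∨ u.length = w.length ∧ u ≤ w) ∧ f u = c

theorem minLead_nil (f : NCSeries α) : MinLead f [] (f []) := by
  refine ⟨fun w _ => ?_, rfl⟩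
  cases w with
  | nil => exact Or.inr ⟨rfl, le_rfl⟩
  | cons a w => exact Or.inl (by simp)

theorem append_le_append {u v s t : List α} (h : u ≤ s) (hl : u.length = s.length) (h' : v ≤ t) :
    u ++ v ≤ s ++ t := by
  rcases h.lt_or_eq with h | rfl
  · exact (append_lt_append_of_length_le h hl.ge v t).le
  · rcases h'.lt_or_eq with h' | rfl
    · exact (List.append_left_lt h').le
    · exact le_rfl

theorem MinLead.mul {f g : NCSeries α} {u v : List α} {c e : ℤ} (hf : MinLead f u c)
    (hg : MinLead g v e) : MinLead (f * g) (u ++ v) (c * e) := by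
  constructor
  · intro w hw
    by_contra hlt
    refine hw (mul_apply_eq_zero fun s t hst => ?_)
    by_contra hne
    have h1 := hf.1 s (left_ne_zero_of_mul hne)
    have h2 := hg.1 t (right_ne_zero_of_mul hne)
    refine hlt ?_
    subst hst
    simp only [List.length_append]
    by_cases hl : u.length = s.length ∧ v.length = t.length
    · exact Or.inr ⟨by omega, append_le_append (h1.resolve_left (by omega)).2 hl.1
        (h2.resolve_left (by omega)).2⟩
    · exact Or.inl (by omega)
  · rw [mul_apply_append, hf.2, hg.2]
    intro s t hst hs
    by_contra hne
    have h1 := hf.1 s (left_ne_zero_of_mul hne)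
    have h2 := hg.1 t (right_ne_zero_of_mul hne)
    have h3 := congrArg List.length hst
    simp only [List.length_append] at h3
    exact hs (List.append_inj_left hst (by omega)).symm

theorem MinLead.mul_right {f : NCSeries α} {u : List α} {c : ℤ} (hf : MinLead f u c)
    (g : NCSeries α) : MinLead (f * g) u (c * g []) := by
  simpa using hf.mul (minLead_nil g)

/-- Since uv < vu, the product in the other order does not reach uv, and the remaining factor in
`mag_commutator` has constant term 1. -/
theorem MinLead.commutator {g h : FreeGroup α} {u v : List α} (hg : MinLead (mag g) u 1)
    (hh : MinLead (mag h) v 1) (huv : u ++ v < v ++ u) : MinLead (mag ⁅g, h⁆) (u ++ v) 1 := by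
  have h1 : MinLead (mag g * mag h - mag h * mag g) (u ++ v) 1 := by
    have hgh := hg.mul hh
    have hhg := hh.mul hg
    constructor
    · intro w hw
      by_cases hz : (mag g * mag h) w = 0
      · have := hhg.1 w fun h0 => hw (by rw [sub_apply, hz, h0, sub_zero])
        simp only [List.length_append] at this ⊢
        rcases this with h | ⟨h, h'⟩
        · exact Or.inl (by omega)
        · exact Or.inr ⟨by omega, huv.le.trans h'⟩
      · exact hgh.1 w hz
    · have hz : (mag h * mag g) (u ++ v) = 0 := by
        by_contra hz
        rcases hhg.1 _ hz with h | ⟨_, h⟩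
        · simp only [List.length_append] at h; omega
        · exact absurd huv (not_lt.2 h)
      rw [sub_apply, hgh.2, hz]; rfl
  have h2 := h1.mul_right (1 + mag (g⁻¹ * h⁻¹))
  rw [← mag_commutator] at h2
  simpa [mag_nil] using h2

/-- The words in the quadratic remainder have length at least 2|u| > |u|. -/
theorem MinLead.pow {g : FreeGroup α} {u : List α} (hg : MinLead (mag g) u 1) (hu : u ≠ []) (m : ℕ) :
    MinLead (mag (g ^ m)) u m := by
  obtain ⟨h, hh⟩ := exists_mag_pow g m
  have h1 := ((hg.mul hg).mul_right h).1
  have hul := List.length_pos_iff.2 hu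
  rw [hh]
  constructor
  · intro w hw
    by_cases hz : (mag g) w = 0
    · rcases h1 w fun h0 => hw (by rw [add_apply, natCast_mul_apply, hz, h0]; simp) with h | ⟨h, _⟩
      · simp only [List.length_append] at h; exact Or.inl (by omega)
      · simp only [List.length_append] at h; exact Or.inl (by omega)
    · exact hg.1 w hz
  · have hz : (mag g * mag g * h) u = 0 := by
      by_contra hz
      have := h1 u hz
      simp only [List.length_append] at this
      omega
    rw [add_apply, natCast_mul_apply, hz, hg.2]; simp

/-- For Lyndon words u < v one has uv < v < vu, as `MinLead.commutator` requires. -/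
theorem minLead_comm {t : LTree α} (ht : t.IsHall) : MinLead (mag t.comm) t.word 1 := by
  induction t with
  | leaf a =>
    refine ⟨fun w hw => ?_, by simp [LTree.comm, LTree.word, X]⟩
    have : w = [a] := by simpa [LTree.comm, X] using hw
    exact Or.inr (by rw [this]; exact ⟨rfl, le_rfl⟩)
  | node l r ihl ihr =>
    have hl := ht.1.isLyndon
    have hr := ht.2.1.isLyndon
    refine (ihl ht.1).commutator (ihr ht.2.1) ?_
    exact (hl.append_lt hr ht.2.2.1).trans (lt_append_of_ne_nil _ hl.1)

end Lead

/-! ### Coefficient functions of the layers -/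

section Sigma

variable [DecidableEq α] {p : ℕ}

/-- The g with `mag g` in `J α p n` form a subgroup. A p-th power gains one degree because its terms
are p f and multiples of f²; a commutator gains one because its terms are products with an element
of `J α p 1`. -/
theorem mag_mem_J {n : ℕ} {g : FreeGroup α} (hg : g ∈ lowerPSeries p (FreeGroup α) n) :
    mag g ∈ J α p n := by
  let D (n : ℕ) : Subgroup (FreeGroup α) :=
    { carrier := {g | mag g ∈ J α p n}
      one_mem' := by simp [zero_mem]
      mul_mem' := fun {a b} ha hb => by
        change mag (a * b) ∈ J α p n
        rw [mag_mul]
        exact add_mem (add_mem ha hb) (mul_mem_J_left _ ha)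
      inv_mem' := fun {a} ha => by
        change mag a⁻¹ ∈ J α p n
        rw [mag_inv]
        exact sub_mem (neg_mem ha) (mul_mem_J_left _ ha) }
  have h1 (g : FreeGroup α) : mag g ∈ J α p 1 := by
    intro w
    cases w with
    | nil => simp [mag_nil]
    | cons a w => simp
  rcases Nat.eq_zero_or_pos n with rfl | hn
  · exact mem_J_zero _ _
  have : lowerPSeries p (FreeGroup α) n ≤ D n := by
    clear hg
    induction n, hn using Nat.le_induction with
    | base => exact fun g _ => h1 g
    | succ n hn ih =>
      refine lowerPSeries_le hn (fun g hg => ?_) fun g hg h => ?_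
      · change mag (g ^ p) ∈ J α p (n + 1)
        obtain ⟨h, hh⟩ := exists_mag_pow g p
        rw [hh]
        exact add_mem (natCast_mul_mem_J (ih hg))
          (mul_mem_J_left _ (J_anti (by omega) (mul_mem_J (ih hg) (ih hg))))
      · change mag ⁅g, h⁆ ∈ J α p (n + 1)
        rw [mag_commutator]
        exact mul_mem_J_left _ (sub_mem (mul_mem_J (ih hg) (h1 h))
          (J_anti (by omega) (mul_mem_J (h1 h) (ih hg))))
  exact this hg

/-- The coefficients of the Magnus expansion of an element of the `n`-th term of the lower
`p`-series, modulo those of the elements of the next term. -/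
def sigma (p n : ℕ) (g : FreeGroup α) : List α → ZMod p := symb p n (mag g)

variable [Fact p.Prime]

theorem sigma_mul {n : ℕ} (hn : 1 ≤ n) {g h : FreeGroup α}
    (hg : g ∈ lowerPSeries p (FreeGroup α) n) (hh : h ∈ lowerPSeries p (FreeGroup α) n) :
    sigma p n (g * h) = sigma p n g + sigma p n h := by
  have hg := mag_mem_J hg
  have hh := mag_mem_J hh
  rw [sigma, sigma, sigma, ← symb_add hg]
  refine symb_congr (add_mem hg hh) ?_
  rw [mag_mul, add_sub_cancel_left]
  exact J_anti (by omega) (mul_mem_J hg hh)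

/-- `sigma` as a homomorphism on the `n`-th term of the lower `p`-series. -/
def sigmaHom (α : Type*) [DecidableEq α] (p : ℕ) [Fact p.Prime] {n : ℕ} (hn : 1 ≤ n) :
    lowerPSeries p (FreeGroup α) n →* Multiplicative (List α → ZMod p) :=
  MonoidHom.mk' (fun g => Multiplicative.ofAdd (sigma p n (g : FreeGroup α)))
    fun g h => congrArg Multiplicative.ofAdd (sigma_mul hn g.2 h.2)

theorem sigma_inv {n : ℕ} (hn : 1 ≤ n) {g : FreeGroup α}
    (hg : g ∈ lowerPSeries p (FreeGroup α) n) : sigma p n g⁻¹ = -sigma p n g :=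
  congrArg Multiplicative.toAdd (map_inv (sigmaHom α p hn) ⟨g, hg⟩)

theorem sigma_zpow {n : ℕ} (hn : 1 ≤ n) {g : FreeGroup α}
    (hg : g ∈ lowerPSeries p (FreeGroup α) n) (m : ℤ) : sigma p n (g ^ m) = m • sigma p n g :=
  congrArg Multiplicative.toAdd (map_zpow (sigmaHom α p hn) ⟨g, hg⟩ m)

@[simp] theorem sigma_one (n : ℕ) : sigma p n (1 : FreeGroup α) = 0 := by
  funext w
  simp [sigma, symb]

theorem sigma_of_lt {n : ℕ} (g : FreeGroup α) {w : List α} (h : n < w.length) :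
    sigma p n g w = 0 := symb_of_lt h

theorem sigma_nil (n : ℕ) (g : FreeGroup α) : sigma p n g [] = 0 := by
  simp [sigma, symb, mag_nil]

theorem sigma_eq_zero_of_mem {n : ℕ} {g : FreeGroup α}
    (hg : g ∈ lowerPSeries p (FreeGroup α) (n + 1)) : sigma p n g = 0 :=
  (symb_eq_zero_iff (mag_mem_J (lowerPSeries_succ_le n hg))).2 (mag_mem_J hg)

/-- The linear term p f has the symbol of f. The quadratic remainder lies in degree 2n, which is at
least n + 2 exactly when n ≥ 2. -/
theorem sigma_pow {n : ℕ} (hn : 2 ≤ n) {g : FreeGroup α}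
    (hg : g ∈ lowerPSeries p (FreeGroup α) n) : sigma p (n + 1) (g ^ p) = sigma p n g := by
  have hg := mag_mem_J hg
  obtain ⟨h, hh⟩ := exists_mag_pow g p
  rw [sigma, sigma, ← symb_natCast_mul hg]
  refine symb_congr (natCast_mul_mem_J hg) ?_
  rw [hh, add_sub_cancel_left]
  exact mul_mem_J_left _ (J_anti (by omega) (mul_mem_J hg hg))

theorem mul_X_apply (f : NCSeries α) (a : α) (w : List α) :
    (f * X a) w = if w.getLast? = some a then f w.dropLast else 0 := by
  rcases List.eq_nil_or_concat w with rfl | ⟨w, b, rfl⟩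
  · simp [X]
  · rw [List.concat_eq_append, mul_X_concat]
    simp

theorem X_mul_apply (f : NCSeries α) (a : α) (w : List α) :
    (X a * f) w = if w.head? = some a then f w.tail else 0 := by
  cases w with
  | nil => simp [X]
  | cons b w => rw [X_mul_cons]; simp

/-- The bracket of a function on words with a variable. -/
def bracketX {R : Type*} [Ring R] (a : α) (v : List α → R) : List α → R := fun w =>
  (if w.getLast? = some a then v w.dropLast else 0) - (if w.head? = some a then v w.tail else 0)

theorem symb_bracket {n : ℕ} {f : NCSeries α} (hf : f ∈ J α p n) (a : α) :
    symb p (n + 1) (f * X a - X a * f) = bracketX a (symb p n f) := by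
  have h1 : symb p (n + 1) (f * X a) =
      symb p (n + 1) (f * X a - X a * f) + symb p (n + 1) (X a * f) := by
    rw [← symb_add, sub_add_cancel]
    exact sub_mem (mul_mem_J hf (X_mem_J p a)) (J_anti (by omega) (mul_mem_J (X_mem_J p a) hf))
  rw [← sub_eq_iff_eq_add] at h1
  rw [← h1]
  funext w
  simp only [Pi.sub_apply, bracketX]
  congr 1
  · rcases List.eq_nil_or_concat w with rfl | ⟨w, b, rfl⟩
    · simp [symb, X]
    · simp only [List.concat_eq_append, symb, mul_X_apply, List.length_append, List.length_singleton,
        List.dropLast_concat, List.getLast?_concat]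
      by_cases hb : b = a
      · simp only [hb, Nat.add_le_add_iff_right, if_true, Nat.add_sub_add_right]
      · simp [hb]
  · cases w with
    | nil => simp [symb, X]
    | cons b w =>
      simp only [symb, X_mul_apply, List.length_cons, List.head?_cons, List.tail_cons]
      by_cases hb : b = a
      · simp only [hb, Nat.add_le_add_iff_right, if_true, Nat.add_sub_add_right]
        by_cases hl : w.length ≤ n <;> simp [hl]
      · simp [hb]

/-- The factor 1 + mag(g⁻¹a⁻¹) in `mag_commutator` changes the bracket only in degree n + 2. -/
theorem sigma_commutator {n : ℕ} {g : FreeGroup α} (hg : g ∈ lowerPSeries p (FreeGroup α) n)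
    (a : α) : sigma p (n + 1) ⁅g, FreeGroup.of a⁆ = bracketX a (sigma p n g) := by
  have hg := mag_mem_J hg
  have hB : mag g * X a - X a * mag g ∈ J α p (n + 1) :=
    sub_mem (mul_mem_J hg (X_mem_J p a)) (J_anti (by omega) (mul_mem_J (X_mem_J p a) hg))
  rw [sigma, sigma, ← symb_bracket hg]
  refine symb_congr hB ?_
  rw [mag_commutator, mag_of, mul_add, mul_one, add_sub_cancel_left]
  exact mul_mem_J hB (mag_mem_J (n := 1) (Subgroup.mem_top _))

theorem mag_singleton_zpow (g : FreeGroup α) (c : α) (m : ℤ) : mag (g ^ m) [c] = m * mag g [c] := by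
  let φ : FreeGroup α →* Multiplicative ℤ :=
    MonoidHom.mk' (fun g => Multiplicative.ofAdd (mag g [c])) fun a b => by
      change Multiplicative.ofAdd _ = Multiplicative.ofAdd (mag a [c] + mag b [c])
      rw [mag_mul, add_apply, mul_cons, mul_nil]
      simp [mag_nil]
  have := congrArg Multiplicative.toAdd (map_zpow φ g m)
  exact this.trans (zsmul_eq_mul _ _)

/-- The coefficients at the powers of a letter are those of a power of the generator. -/
theorem exists_zpow_replicate (g : FreeGroup α) (c : α) : ∃ m : ℤ, ∀ k,
    mag g (List.replicate k c) = mag (FreeGroup.of c ^ m) (List.replicate k c) := by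
  induction g using FreeGroup.induction_on with
  | C1 => exact ⟨0, by simp⟩
  | of a =>
    by_cases h : a = c
    · exact ⟨1, by simp [h]⟩
    · refine ⟨0, fun k => ?_⟩
      rw [mag_of, X, if_neg]
      · simp
      · intro hk
        have : a ∈ List.replicate k c := by rw [hk]; simp
        exact h (List.eq_of_mem_replicate this)
  | inv_of a _ =>
    by_cases h : a = c
    · exact ⟨-1, by simp [h]⟩
    · refine ⟨0, fun k => ?_⟩
      have h1 : mag (FreeGroup.of a)⁻¹ = oneAddXInv a - 1 := by
        simp [mag, magnus, oneAddX]
      rw [h1, zpow_zero, mag_one]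
      cases k with
      | zero => simp [oneAddXInv]
      | succ k => simp [oneAddXInv, List.replicate_succ, Ne.symm h]
  | mul x y hx hy =>
    obtain ⟨m, hm⟩ := hx
    obtain ⟨m', hm'⟩ := hy
    refine ⟨m + m', fun k => ?_⟩
    rw [zpow_add, mag_mul, mag_mul]
    simp only [add_apply]
    rw [hm k, hm' k, mul_replicate_congr hm hm' k]

/-- At the powers of c, the element g looks like a power c^m. If the coefficient at c vanishes then
p^n divides m, so c^m lies in P_{n+1} and all the other coefficients vanish as well. -/
theorem sigma_replicate {n : ℕ} (hn : 1 ≤ n) {g : FreeGroup α}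
    (hg : g ∈ lowerPSeries p (FreeGroup α) n) {c : α} (hc : sigma p n g [c] = 0) (k : ℕ) :
    sigma p n g (List.replicate k c) = 0 := by
  obtain ⟨m, hm⟩ := exists_zpow_replicate g c
  have h1 : (p : ℤ) ^ n ∣ m := by
    have h := (symb_apply_eq_zero_iff (mag_mem_J hg) (w := [c]) (by simpa using hn)).1 hc
    have h2 := hm 1
    rw [List.replicate_one, mag_singleton_zpow, mag_of] at h2
    rw [h2] at h
    simpa [X] using h
  obtain ⟨m', rfl⟩ := h1
  have h2 : FreeGroup.of c ^ ((p : ℤ) ^ n * m') ∈ lowerPSeries p (FreeGroup α) (n + 1) := by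
    rw [zpow_mul]
    refine zpow_mem ?_ _
    have h := pow_pow_mem_lowerPSeries (p := p) (n := 1) (Subgroup.mem_top (FreeGroup.of c)) n
    rw [add_comm] at h
    exact_mod_cast h
  by_cases hk : (List.replicate k c).length ≤ n
  · refine (symb_apply_eq_zero_iff (mag_mem_J hg) hk).2 ?_
    rw [hm k]
    exact mag_mem_J h2 _
  · exact sigma_of_lt g (by omega)

end Sigma

/-! ### Injectivity of the coefficient map on layers -/

section Injective

variable [LinearOrder α] {p : ℕ} [Fact p.Prime]

theorem minLead_commPow {t : LTree α} (ht : t.IsHall) (p n : ℕ) :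
    MinLead (mag (t.commPow p n)) t.word ((p ^ (n - t.weight) : ℕ) : ℤ) :=
  (minLead_comm ht).pow t.word_ne_nil _

theorem sigma_commPow_word {t : LTree α} (ht : t.IsHall) {n : ℕ} (hn : t.weight ≤ n) :
    sigma p n (t.commPow p n) t.word = 1 := by
  have h := (minLead_commPow ht p n).2
  rw [sigma, symb_apply_of_eq_mul hn (c := 1) (by rw [h]; push_cast; ring), Int.cast_one]

theorem sigma_commPow_eq_zero {t : LTree α} (ht : t.IsHall) {n : ℕ} {w : List α}
    (hw : w.length < t.weight ∨ w.length = t.weight ∧ w < t.word) :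
    sigma p n (t.commPow p n) w = 0 := by
  have h : mag (t.commPow p n) w = 0 := by
    by_contra h
    rcases (minLead_commPow ht p n).1 w h with h | ⟨h, h'⟩
    · have : t.weight < w.length := h
      omega
    · have : t.weight = w.length := h
      rcases hw with hw | hw
      · omega
      · exact absurd hw.2 (not_lt.2 h')
  simp [sigma, symb, h]

/-- Triangular elimination: the tree with the least leading word is split off, and its exponent is
read off at that word. -/
theorem mem_of_mem_closure_of_sigma_eq_zero {n : ℕ} (hn : 1 ≤ n) (s : Finset (LTree α))
    (hs : ∀ t ∈ s, t.IsHall ∧ t.weight ≤ n) {g : FreeGroup α}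
    (hg : g ∈ Subgroup.closure (LTree.commPow p n '' s ∪ lowerPSeries p (FreeGroup α) (n + 1)))
    (h0 : sigma p n g = 0) : g ∈ lowerPSeries p (FreeGroup α) (n + 1) := by
  classical
  induction s using Finset.induction_on_min_value (fun t : LTree α => toLex (t.weight, t.word))
    generalizing g with
  | empty => simpa using hg
  | insert a s ha hmin ih =>
    have hs' : ∀ t ∈ s, t.IsHall ∧ t.weight ≤ n := fun t ht => hs t (Finset.mem_insert_of_mem ht)
    have haH := hs a (Finset.mem_insert_self a s)
    set T := LTree.commPow p n '' s ∪ (lowerPSeries p (FreeGroup α) (n + 1) : Set (FreeGroup α))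
      with hT
    have hTle : Subgroup.closure T ≤ lowerPSeries p (FreeGroup α) n := by
      refine (Subgroup.closure_le _).2 (Set.union_subset ?_ (lowerPSeries_succ_le n))
      rintro _ ⟨t, ht, rfl⟩
      exact LTree.commPow_mem (hs' t ht).2
    have hnorm : (Subgroup.closure T).Normal :=
      normal_of_between (fun x hx => Subgroup.subset_closure (Or.inr hx)) hTle
    rw [Finset.coe_insert, Set.image_insert_eq, Set.insert_union, ← hT, Set.insert_eq,
      Subgroup.closure_union, ← Subgroup.zpowers_eq_closure, Subgroup.mem_sup_of_normal_right] at hg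
    obtain ⟨_, ⟨e, rfl⟩, y, hy, rfl⟩ := hg
    have hβ := LTree.commPow_mem (p := p) haH.2
    simp only at h0 ⊢
    rw [sigma_mul hn (zpow_mem hβ e) (hTle hy), sigma_zpow hn hβ] at h0
    have hyw : sigma p n y a.word = 0 := by
      suffices y ∈ lowerPSeries p (FreeGroup α) n ∧ sigma p n y a.word = 0 from this.2
      clear h0
      induction hy using Subgroup.closure_induction with
      | mem x hx =>
        refine ⟨hTle (Subgroup.subset_closure hx), ?_⟩
        rcases hx with ⟨t, ht, rfl⟩ | hx
        · refine sigma_commPow_eq_zero (hs' t ht).1 ?_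
          have h1 := hmin t ht
          rw [Prod.Lex.toLex_le_toLex] at h1
          rcases h1 with h1 | ⟨h1, h2⟩
          · exact Or.inl h1
          · refine Or.inr ⟨h1, lt_of_le_of_ne h2 fun h => ha ?_⟩
            rw [haH.1.word_injective (hs' t ht).1 h]
            exact ht
        · rw [sigma_eq_zero_of_mem hx]; rfl
      | one => exact ⟨one_mem _, by simp⟩
      | mul x y _ _ hx hy =>
        refine ⟨mul_mem hx.1 hy.1, ?_⟩
        rw [sigma_mul hn hx.1 hy.1, Pi.add_apply, hx.2, hy.2, add_zero]
      | inv x _ hx =>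
        refine ⟨inv_mem hx.1, ?_⟩
        rw [sigma_inv hn hx.1, Pi.neg_apply, hx.2, neg_zero]
    -- At the word of a, the power of a contributes e, and y contributes 0 because its trees have
    -- larger leading words. Hence p divides e.
    have he := congrFun h0 a.word
    rw [Pi.add_apply, Pi.smul_apply, hyw, sigma_commPow_word haH.1 haH.2, add_zero, zsmul_one,
      Pi.zero_apply, ZMod.intCast_zmod_eq_zero_iff_dvd] at he
    obtain ⟨e', rfl⟩ := he
    have hβ' : a.commPow p n ^ ((p : ℤ) * e') ∈ lowerPSeries p (FreeGroup α) (n + 1) := by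
      rw [zpow_mul, zpow_natCast]
      exact zpow_mem (pow_mem_lowerPSeries hβ) _
    refine mul_mem hβ' (ih hs' hy ?_)
    rwa [← sigma_zpow hn hβ, sigma_eq_zero_of_mem hβ', zero_add] at h0

/-- The Magnus coefficients separate the elements of a term of the lower `p`-series modulo the
next term. -/
theorem sigma_eq_zero_iff [Finite α] {n : ℕ} (hn : 1 ≤ n) {g : FreeGroup α}
    (hg : g ∈ lowerPSeries p (FreeGroup α) n) :
    sigma p n g = 0 ↔ g ∈ lowerPSeries p (FreeGroup α) (n + 1) := by
  refine ⟨fun h => ?_, sigma_eq_zero_of_mem⟩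
  have hfin := LTree.finite_isHall_weight_le (α := α) n
  refine mem_of_mem_closure_of_sigma_eq_zero hn hfin.toFinset (fun t ht => by simpa using ht) ?_ h
  refine Subgroup.closure_mono (Set.union_subset_union_left _ ?_) (LTree.lowerPSeries_le_powSpan p hn hg)
  rintro _ ⟨t, ht, hw, rfl⟩
  exact ⟨t, by simpa using ⟨ht, hw⟩, rfl⟩

end Injective

end NCSeries

/-! ### Dimension as the number of leading indices -/

section Leads

variable {ι K k : Type*} [LinearOrder K] [Field k] (κ : ι → K)

/-- The indices at which some element of `V` has its nonzero coordinate of largest key. -/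
def leads (V : Set (ι → k)) : Set ι := {u | ∃ v ∈ V, v u ≠ 0 ∧ ∀ w, v w ≠ 0 → κ w ≤ κ u}

variable {κ} {V : Submodule k (ι → k)} {S : Set ι}

theorem leads_subset (hV : ∀ v ∈ V, ∀ w, v w ≠ 0 → w ∈ S) :
    leads κ (V : Set (ι → k)) ⊆ S := by
  rintro u ⟨v, hv, hu, _⟩
  exact hV v hv u hu

/-- A nonzero element of V does not vanish at its own leading index. -/
theorem restrict_leads_injective (hS : S.Finite) (hV : ∀ v ∈ V, ∀ w, v w ≠ 0 → w ∈ S) :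
    Function.Injective ((LinearMap.funLeft k k
      (Subtype.val : leads κ (V : Set (ι → k)) → ι)).comp V.subtype) := by
  rw [injective_iff_map_eq_zero]
  rintro ⟨v, hv⟩ h0
  by_contra hne
  obtain ⟨w, hw⟩ : ∃ w, v w ≠ 0 := by
    by_contra! hall
    exact hne (Subtype.ext (funext hall))
  have hfin : {w | v w ≠ 0}.Finite := hS.subset fun w hw => hV v hv w hw
  obtain ⟨u, hu, hmax⟩ := Set.exists_max_image _ κ hfin ⟨w, hw⟩
  exact hu (congrFun h0 ⟨u, v, hv, hu, hmax⟩)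

theorem finite_of_support (hS : S.Finite) (hV : ∀ v ∈ V, ∀ w, v w ≠ 0 → w ∈ S) :
    Module.Finite k V := by
  have : Finite S := hS
  refine Module.Finite.of_injective ((LinearMap.funLeft k k (Subtype.val : S → ι)).comp V.subtype) ?_
  rw [injective_iff_map_eq_zero]
  rintro ⟨v, hv⟩ h0
  refine Subtype.ext (funext fun w => ?_)
  by_contra hw
  exact hw (congrFun h0 ⟨w, hV v hv w hw⟩)

/-- The dimension of a space of finitely supported functions is its number of leading indices. -/
theorem finrank_eq_ncard_leads (hκ : Function.Injective κ) (hS : S.Finite)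
    (hV : ∀ v ∈ V, ∀ w, v w ≠ 0 → w ∈ S) :
    Module.finrank k V = (leads κ (V : Set (ι → k))).ncard := by
  have hfin : (leads κ (V : Set (ι → k))).Finite := hS.subset (leads_subset hV)
  have := hfin.fintype
  have := finite_of_support hS hV
  rw [← Nat.card_coe_set_eq, Nat.card_eq_fintype_card]
  refine le_antisymm ?_ ?_
  · have h := LinearMap.finrank_le_finrank_of_injective (restrict_leads_injective (κ := κ) hS hV)
    rwa [Module.finrank_fintype_fun_eq_card] at h
  -- Vectors with distinct leading indices are independent: at the largest one with nonzero scalar,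
  -- all the other terms vanish.
  · choose v hv hvu hmax using fun u : leads κ (V : Set (ι → k)) => u.2
    have hli : LinearIndependent k fun u => (⟨v u, hv u⟩ : V) := by
      classical
      rw [linearIndependent_iff']
      intro s g hg
      by_contra! hne
      obtain ⟨i, hi, hgi⟩ := hne
      obtain ⟨j, hj, hjmax⟩ := Finset.exists_max_image (s.filter fun i => g i ≠ 0)
        (fun i => κ i.1) ⟨i, Finset.mem_filter.2 ⟨hi, hgi⟩⟩
      rw [Finset.mem_filter] at hj
      have h1 := congrFun (congrArg Subtype.val hg) j.1
      have h2 : ∑ i ∈ s, g i * v i j.1 = 0 := by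
        simpa [Finset.sum_apply] using h1
      rw [Finset.sum_eq_single_of_mem j hj.1] at h2
      · exact (mul_ne_zero hj.2 (hvu j)) h2
      · intro i hi hij
        by_contra h
        have h3 := hmax i j.1 (right_ne_zero_of_mul h)
        have h4 := hjmax i (Finset.mem_filter.2 ⟨hi, left_ne_zero_of_mul h⟩)
        exact hij (Subtype.ext (hκ (le_antisymm h4 h3)))
    exact hli.fintype_card_le_finrank

end Leads

/-! ### Leading words of brackets with a letter -/

section Keys

/-- A largest letter counts for more at the front than at the end, unless both words are powers of
it. This is used for masks (with `true`) and for words (with x). -/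
theorem append_singleton_lt_cons {α : Type*} [LinearOrder α] {m : α} (hm : ∀ a, a ≤ m) {l' l : List α}
    (hl : l'.length = l.length) (h : l' ≤ l) (hne : (∃ c ∈ l', c ≠ m) ∨ ∃ c ∈ l, c ≠ m) :
    l' ++ [m] < m :: l := by
  induction l' generalizing l with
  | nil =>
    obtain rfl : l = [] := List.length_eq_zero_iff.1 (by simpa using hl.symm)
    simp at hne
  | cons c' l' ih =>
    obtain _ | ⟨c, l⟩ := l
    · simp at hl
    rw [List.cons_append, List.cons_lt_cons_iff]
    rcases (hm c').lt_or_eq with hc | rfl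
    · exact Or.inl hc
    · have h1 : c = c' ∧ l' ≤ l := by
        rcases h.lt_or_eq with h | h
        · rcases List.cons_lt_cons_iff.1 h with h | ⟨h, h'⟩
          · exact absurd (hm c) (not_le.2 h)
          · exact ⟨h.symm, h'.le⟩
        · rw [List.cons.injEq] at h
          exact ⟨h.1.symm, h.2.le⟩
      obtain ⟨rfl, h1⟩ := h1
      exact Or.inr ⟨rfl, ih (by simpa using hl) h1 (by simpa using hne)⟩

theorem cons_lt_append_singleton {α : Type*} [LinearOrder α] {m : α} (hm : ∀ a, m ≤ a) {l' l : List α}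
    (h : l' ≤ l) (hne : ∃ c ∈ l, c ≠ m) : m :: l' < l ++ [m] := by
  refine lt_of_le_of_lt (b := m :: l) (List.cons_le_cons m h) ?_
  clear h
  induction l with
  | nil => simp at hne
  | cons c l ih =>
    rw [List.cons_append, List.cons_lt_cons_iff]
    rcases (hm c).lt_or_eq with hc | rfl
    · exact Or.inl hc
    · exact Or.inr ⟨rfl, ih (by simpa using hne)⟩

variable {α : Type*} [LinearOrder α]

/-- The word of truth values recording which letters differ from `z`. -/
def mask (z : α) (w : List α) : List Bool := w.map fun a => decide (a ≠ z)

/-- The key by which words are compared: shorter words are larger, then the masks are compared,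
then the words. -/
def key (z : α) (w : List α) : ℕᵒᵈ ×ₗ (List Bool ×ₗ List α) :=
  toLex (OrderDual.toDual w.length, toLex (mask z w, w))

theorem key_injective (z : α) : Function.Injective (key z) := by
  intro w w' h
  have h1 := congrArg (fun q => (ofLex (ofLex q).2).2) h
  exact h1

theorem key_le_iff {z : α} {w u : List α} : key z w ≤ key z u ↔ u.length < w.length ∨
    w.length = u.length ∧ (mask z w < mask z u ∨ mask z w = mask z u ∧ w ≤ u) := by
  rw [key, key, Prod.Lex.toLex_le_toLex, Prod.Lex.toLex_le_toLex]
  rfl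

theorem key_lt_iff {z : α} {w u : List α} : key z w < key z u ↔ u.length < w.length ∨
    w.length = u.length ∧ (mask z w < mask z u ∨ mask z w = mask z u ∧ w < u) := by
  rw [key, key, Prod.Lex.toLex_lt_toLex, Prod.Lex.toLex_lt_toLex]
  rfl

@[simp] theorem length_mask (z : α) (w : List α) : (mask z w).length = w.length := by simp [mask]

theorem mask_cons (z a : α) (w : List α) : mask z (a :: w) = decide (a ≠ z) :: mask z w := rfl

theorem mask_append (z : α) (w w' : List α) : mask z (w ++ w') = mask z w ++ mask z w' := by
  simp [mask]

theorem mask_eq_replicate {z : α} {w : List α} (h : z ∉ w) :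
    mask z w = List.replicate w.length true := by
  rw [List.eq_replicate_iff]
  refine ⟨length_mask z w, fun b hb => ?_⟩
  obtain ⟨a, ha, rfl⟩ := List.mem_map.1 hb
  simpa using fun h' : a = z => h (h' ▸ ha)

theorem key_cons_le {z : α} {w u : List α} (a : α) (h : key z w ≤ key z u) :
    key z (a :: w) ≤ key z (a :: u) := by
  rw [key_le_iff] at h ⊢
  simp only [List.length_cons, mask_cons]
  rcases h with h | ⟨h, h1 | ⟨h1, h2⟩⟩
  · exact Or.inl (by omega)
  · exact Or.inr ⟨by omega, Or.inl (List.cons_lt_cons_iff.2 (Or.inr ⟨rfl, h1⟩))⟩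
  · exact Or.inr ⟨by omega, Or.inr ⟨by rw [h1], List.cons_le_cons a h2⟩⟩

theorem key_append_le {z : α} {w u : List α} (a : α) (h : key z w ≤ key z u) :
    key z (w ++ [a]) ≤ key z (u ++ [a]) := by
  rw [key_le_iff] at h ⊢
  simp only [List.length_append, List.length_singleton, mask_append]
  rcases h with h | ⟨h, h1 | ⟨h1, h2⟩⟩
  · exact Or.inl (by omega)
  · refine Or.inr ⟨by omega, Or.inl (append_lt_append_of_length_le h1 ?_ _ _)⟩
    rw [length_mask, length_mask, h]
  · exact Or.inr ⟨by omega, Or.inr ⟨by rw [h1], NCSeries.append_le_append h2 h le_rfl⟩⟩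

theorem mask_le_of_key_le {z : α} {w u : List α} (hl : w.length = u.length)
    (h : key z w ≤ key z u) : mask z w ≤ mask z u := by
  rw [key_le_iff] at h
  rcases h with h | ⟨_, h | ⟨h, _⟩⟩
  · omega
  · exact h.le
  · exact h.le

theorem exists_mem_mask_ne_true {z : α} {u : List α} (h : z ∈ u) : ∃ c ∈ mask z u, c ≠ true :=
  ⟨false, List.mem_map.2 ⟨z, h, by simp⟩, by simp⟩

/-- The masks already decide: the one of u contains `false`, and a contributes the largest value
`true`. So every letter a ≠ z behaves like a largest letter. -/
theorem key_append_lt_cons_of_mem {z a : α} (ha : a ≠ z) {w u : List α} (hu : z ∈ u)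
    (h : key z w ≤ key z u) : key z (w ++ [a]) < key z (a :: u) := by
  rcases (key_le_iff.1 h) with hl | ⟨hl, _⟩
  · exact key_lt_iff.2 (Or.inl (by simpa using hl))
  · refine key_lt_iff.2 (Or.inr ⟨by simpa using hl, Or.inl ?_⟩)
    rw [mask_append, mask_cons, mask_cons, decide_eq_true ha]
    exact append_singleton_lt_cons (fun b => le_top) (by simpa using hl) (mask_le_of_key_le hl h)
      (Or.inr (exists_mem_mask_ne_true hu))

/-- If z occurs in w, the masks decide. If not, both masks consist of `true` only, and the words are
compared, where x is the largest letter. -/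
theorem key_append_lt_cons_of_notMem {z x : α} (hx : ∀ a, a ≤ x) (hxz : x ≠ z) {w u : List α}
    (hu : z ∉ u) (hux : ∃ c ∈ u, c ≠ x) (h : key z w ≤ key z u) :
    key z (w ++ [x]) < key z (x :: u) := by
  rcases (key_le_iff.1 h) with hl | ⟨hl, h'⟩
  · exact key_lt_iff.2 (Or.inl (by simpa using hl))
  · refine key_lt_iff.2 (Or.inr ⟨by simpa using hl, ?_⟩)
    rw [mask_append, mask_cons, mask_cons, decide_eq_true hxz]
    by_cases hw : z ∈ w
    · exact Or.inl (append_singleton_lt_cons (fun b => le_top) (by simpa using hl)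
        (mask_le_of_key_le hl h) (Or.inl (exists_mem_mask_ne_true hw)))
    · have hm : mask z w = mask z u := by rw [mask_eq_replicate hw, mask_eq_replicate hu, hl]
      refine Or.inr ⟨?_, append_singleton_lt_cons hx hl ?_ (Or.inr hux)⟩
      · rw [hm, mask_eq_replicate hu]
        exact List.replicate_succ'.symm.trans List.replicate_succ
      · rcases h' with h' | ⟨_, h'⟩
        · exact absurd h' (by rw [hm]; exact lt_irrefl _)
        · exact h'

/-- In masks z is the smallest value `false`, so it counts for more at the end than at the front. -/
theorem key_cons_lt_append {z : α} {w u : List α} (hu : ∃ c ∈ u, c ≠ z)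
    (h : key z w ≤ key z u) : key z (z :: w) < key z (u ++ [z]) := by
  rcases (key_le_iff.1 h) with hl | ⟨hl, _⟩
  · exact key_lt_iff.2 (Or.inl (by simpa using hl))
  · refine key_lt_iff.2 (Or.inr ⟨by simpa using hl, Or.inl ?_⟩)
    have hz : decide (z ≠ z) = false := by simp
    rw [mask_append, mask_cons, mask_cons, hz]
    obtain ⟨c, hc, hcz⟩ := hu
    exact cons_lt_append_singleton (fun b => bot_le) (mask_le_of_key_le hl h)
      ⟨true, List.mem_map.2 ⟨c, hc, by simpa using hcz⟩, by simp⟩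

open NCSeries

variable {R : Type*} [Ring R] {z : α} {v : List α → R} {u : List α}

theorem bracketX_ne_zero {a : α} {w' : List α} (h : bracketX a v w' ≠ 0) :
    ∃ w, v w ≠ 0 ∧ (w' = w ++ [a] ∨ w' = a :: w) := by
  by_contra! hc
  refine h ?_
  have h1 : (if w'.getLast? = some a then v w'.dropLast else 0) = 0 := by
    split_ifs with hl
    · by_contra hv
      exact (hc _ hv).1 (List.dropLast_append_getLast? a hl).symm
    · rfl
  have h2 : (if w'.head? = some a then v w'.tail else 0) = 0 := by
    split_ifs with hl
    · by_contra hv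
      exact (hc _ hv).2 (List.cons_head?_tail hl).symm
    · rfl
  rw [bracketX, h1, h2, sub_zero]

/-- All words of v X_a stay strictly below au, so nothing cancels the coefficient of X_a v at au. -/
theorem lead_bracketX_cons {a : α} (hu : v u ≠ 0) (hmax : ∀ w, v w ≠ 0 → key z w ≤ key z u)
    (h : ∀ w, key z w ≤ key z u → key z (w ++ [a]) < key z (a :: u)) :
    bracketX a v (a :: u) ≠ 0 ∧
      ∀ w, bracketX a v w ≠ 0 → key z w ≤ key z (a :: u) := by
  constructor
  · have h1 : (if (a :: u).getLast? = some a then v (a :: u).dropLast else 0) = 0 := by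
      split_ifs with hl
      · by_contra hv
        have := h _ (hmax _ hv)
        rw [List.dropLast_append_getLast? a hl] at this
        exact lt_irrefl _ this
      · rfl
    rw [bracketX, h1]
    simpa using hu
  · intro w' hw'
    obtain ⟨w, hw, rfl | rfl⟩ := bracketX_ne_zero hw'
    · exact (h w (hmax w hw)).le
    · exact key_cons_le a (hmax w hw)

theorem lead_bracketX_append {a : α} (hu : v u ≠ 0) (hmax : ∀ w, v w ≠ 0 → key z w ≤ key z u)
    (h : ∀ w, key z w ≤ key z u → key z (a :: w) < key z (u ++ [a])) :
    bracketX a v (u ++ [a]) ≠ 0 ∧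
      ∀ w, bracketX a v w ≠ 0 → key z w ≤ key z (u ++ [a]) := by
  constructor
  · have h1 : (if (u ++ [a]).head? = some a then v (u ++ [a]).tail else 0) = 0 := by
      split_ifs with hl
      · by_contra hv
        have := h _ (hmax _ hv)
        rw [List.cons_head?_tail hl] at this
        exact lt_irrefl _ this
      · rfl
    rw [bracketX, h1]
    simpa using hu
  · intro w' hw'
    obtain ⟨w, hw, rfl | rfl⟩ := bracketX_ne_zero hw'
    · exact key_append_le a (hmax w hw)
    · exact (h w (hmax w hw)).le

theorem card_image_disjUnion_le {A B : Finset (List α)} {x y : α} (hxy : x ≠ y)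
    (hx : ∀ u ∈ A, x :: u ∈ B) (hy : ∀ u ∈ A, y :: u ∈ B) : 2 * A.card ≤ B.card := by
  have h1 : Disjoint (A.image (List.cons x)) (A.image (List.cons y)) := by
    rw [Finset.disjoint_left]
    intro w h1 h2
    obtain ⟨u, _, rfl⟩ := Finset.mem_image.1 h1
    obtain ⟨u', _, h⟩ := Finset.mem_image.1 h2
    exact hxy (List.cons.inj h).1.symm
  have h2 : A.image (List.cons x) ∪ A.image (List.cons y) ⊆ B := by
    refine Finset.union_subset ?_ ?_ <;> intro w hw <;> obtain ⟨u, hu, rfl⟩ := Finset.mem_image.1 hw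
    exacts [hx u hu, hy u hu]
  have h3 := Finset.card_le_card h2
  rw [Finset.card_union_of_disjoint h1, Finset.card_image_of_injective _ List.cons_injective,
    Finset.card_image_of_injective _ List.cons_injective] at h3
  omega

/-- A is split into letters (A₁) and longer words with (A₃) or without (A₄) the letter z. In B,
letters (B₁), words of length 2 (B₂), and longer words with (B₃) or without (B₄) z receive the
images. -/
theorem card_le_of_cons_append_mem {A B : Finset (List α)} {z x y : α} (hxz : x ≠ z) (hyz : y ≠ z)
    (hxy : x ≠ y) (hne : ∀ u ∈ A, u ≠ []) (hpure : ∀ u ∈ A, 2 ≤ u.length → ∀ c, ∃ c' ∈ u, c' ≠ c)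
    (hB : ∀ u ∈ A, u ∈ B) (hmem : ∀ u ∈ A, z ∈ u → ∀ a ≠ z, a :: u ∈ B)
    (hnotMem : ∀ u ∈ A, z ∉ u → (∃ c ∈ u, c ≠ x) → x :: u ∈ B)
    (happ : ∀ u ∈ A, (∃ c ∈ u, c ≠ z) → u ++ [z] ∈ B) : 3 * A.card ≤ 2 * B.card := by
  let A₁ := A.filter fun u => u.length = 1
  let A₂ := A.filter fun u => ¬ u.length = 1
  let A₃ := A₂.filter fun u => z ∈ u
  let A₄ := A₂.filter fun u => ¬ z ∈ u
  let B₁ := B.filter fun u => u.length = 1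
  let B' := B.filter fun u => ¬ u.length = 1
  let B₂ := B'.filter fun u => u.length = 2
  let B'' := B'.filter fun u => ¬ u.length = 2
  let B₃ := B''.filter fun u => z ∈ u
  let B₄ := B''.filter fun u => ¬ z ∈ u
  have a1 : A₁.card + A₂.card = A.card := Finset.card_filter_add_card_filter_not _
  have a2 : A₃.card + A₄.card = A₂.card := Finset.card_filter_add_card_filter_not _
  have b1 : B₁.card + B'.card = B.card := Finset.card_filter_add_card_filter_not _
  have b2 : B₂.card + B''.card = B'.card := Finset.card_filter_add_card_filter_not _
  have b3 : B₃.card + B₄.card = B''.card := Finset.card_filter_add_card_filter_not _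
  have hA₂ : ∀ u ∈ A₂, u ∈ A ∧ 2 ≤ u.length := by
    intro u hu
    rw [Finset.mem_filter] at hu
    have := List.length_pos_iff.2 (hne u hu.1)
    exact ⟨hu.1, by omega⟩
  have mB₃ {w : List α} (h : w ∈ B) (hl : 3 ≤ w.length) (hz : z ∈ w) : w ∈ B₃ := by
    simp only [B₃, B'', B', Finset.mem_filter]
    exact ⟨⟨⟨h, by omega⟩, by omega⟩, hz⟩
  have c1 : A₁.card ≤ B₁.card := by
    refine Finset.card_le_card fun u hu => ?_
    rw [Finset.mem_filter] at hu ⊢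
    exact ⟨hB u hu.1, hu.2⟩
  have mB₂ {w : List α} (h : w ∈ B) (hl : w.length = 2) : w ∈ B₂ := by
    simp only [B₂, B', Finset.mem_filter]
    exact ⟨⟨h, by omega⟩, hl⟩
  -- Appending z misses only the word z itself; if z is in A₁, then xz is in B₂, so the missing word
  -- is also covered by |B₂|.
  have c2 : A₁.card ≤ 2 * B₂.card := by
    have h1 : (A₁.erase [z]).card ≤ B₂.card := by
      refine Finset.card_le_card_of_injOn (· ++ [z]) (fun u hu => ?_)
        (fun u _ u' _ h => List.append_cancel_right h)
      rw [Finset.mem_coe, Finset.mem_erase, Finset.mem_filter] at hu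
      obtain ⟨c, rfl⟩ := List.length_eq_one_iff.1 hu.2.2
      exact mB₂ (happ _ hu.2.1 ⟨c, by simp, fun h => hu.1 (by rw [h])⟩) rfl
    by_cases hz : [z] ∈ A₁
    · have h2 := Finset.card_erase_add_one hz
      have h3 : 0 < B₂.card := Finset.card_pos.2
        ⟨[x, z], mB₂ (hmem _ (Finset.mem_filter.1 hz).1 (by simp) x hxz) rfl⟩
      omega
    · rw [Finset.erase_eq_of_notMem hz] at h1
      omega
  have c3 : 2 * A₃.card ≤ B₃.card := by
    have h1 (a : α) (ha : a ≠ z) (u : List α) (hu : u ∈ A₃) : a :: u ∈ B₃ := by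
      obtain ⟨hu, hz⟩ := Finset.mem_filter.1 hu
      have h2 := hA₂ u hu
      exact mB₃ (hmem u h2.1 hz a ha) (by rw [List.length_cons]; omega) (List.mem_cons_of_mem _ hz)
    exact card_image_disjUnion_le hxy (h1 x hxz) (h1 y hyz)
  have c4 : A₂.card ≤ B₃.card := by
    refine Finset.card_le_card_of_injOn (· ++ [z]) (fun u hu => ?_)
      (fun u _ u' _ h => List.append_cancel_right h)
    have h2 := hA₂ u hu
    exact mB₃ (happ u h2.1 (hpure u h2.1 h2.2 z))
      (by rw [List.length_append, List.length_singleton]; omega) (by simp)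
  have c5 : A₄.card ≤ B₄.card := by
    refine Finset.card_le_card_of_injOn (List.cons x) (fun u hu => ?_)
      (fun u _ u' _ h => (List.cons.inj h).2)
    obtain ⟨hu, hz⟩ := Finset.mem_filter.1 hu
    have h2 := hA₂ u hu
    have h3 := hnotMem u h2.1 hz (hpure u h2.1 h2.2 x)
    simp only [B₄, B'', B', Finset.coe_filter, Set.mem_ofPred_eq, Finset.mem_filter, List.length_cons,
      List.mem_cons]
    refine ⟨⟨⟨h3, by omega⟩, by omega⟩, fun h => h.elim (fun h => hxz h.symm) hz⟩
  -- 2|B₁| + 2|B₂| ≥ 3|A₁| by c1 and c2, and 2|B₃| + 2|B₄| ≥ 2|A₃| + |A₂| + 2|A₄| = 3|A₂| by c3, c4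
  -- and c5.
  omega

end Keys

/-! ### Dimension inequalities for spaces of coefficient functions -/

namespace NCSeries

section LayerSpace

variable {α : Type*} {p : ℕ} [Fact p.Prime]

/-- The space of the coefficient functions of the elements of `K` in the `n`-th term of the lower
`p`-series. -/
def layerSpace [DecidableEq α] {n : ℕ} (hn : 1 ≤ n) (K : Subgroup (FreeGroup α)) :
    Submodule (ZMod p) (List α → ZMod p) where
  carrier := {v | ∃ g ∈ K, g ∈ lowerPSeries p (FreeGroup α) n ∧ sigma p n g = v}
  zero_mem' := ⟨1, one_mem _, one_mem _, sigma_one n⟩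
  add_mem' := by
    rintro _ _ ⟨g, hg, hg', rfl⟩ ⟨h, hh, hh', rfl⟩
    exact ⟨g * h, mul_mem hg hh, mul_mem hg' hh', sigma_mul hn hg' hh'⟩
  smul_mem' := by
    rintro c _ ⟨g, hg, hg', rfl⟩
    refine ⟨g ^ (c.val : ℤ), zpow_mem hg _, zpow_mem hg' _, ?_⟩
    rw [sigma_zpow hn hg', natCast_zsmul, ← Nat.cast_smul_eq_nsmul (ZMod p), ZMod.natCast_zmod_val]

theorem layerSpace_support [DecidableEq α] {n : ℕ} (hn : 1 ≤ n) (K : Subgroup (FreeGroup α)) :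
    ∀ v ∈ layerSpace (p := p) hn K, ∀ w, v w ≠ 0 → w ∈ {w : List α | w.length ≤ n} := by
  rintro _ ⟨g, _, _, rfl⟩ w hw
  by_contra h
  exact hw (sigma_of_lt g (not_le.1 h))

instance layerSpace_finite [DecidableEq α] [Finite α] {n : ℕ} (hn : 1 ≤ n)
    (K : Subgroup (FreeGroup α)) : Module.Finite (ZMod p) (layerSpace (p := p) hn K) :=
  finite_of_support (List.finite_length_le α n) (layerSpace_support hn K)

theorem finrank_layerSpace_le [DecidableEq α] [Finite α] {n : ℕ} (hn : 2 ≤ n)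
    {K K' : Subgroup (FreeGroup α)} (h : ∀ g ∈ K, g ^ p ∈ K') :
    Module.finrank (ZMod p) (layerSpace (p := p) (one_le_two.trans hn) K) ≤
      Module.finrank (ZMod p) (layerSpace (p := p) (Nat.le_add_left 1 n) K') := by
  refine Submodule.finrank_mono ?_
  rintro _ ⟨g, hg, hg', rfl⟩
  exact ⟨g ^ p, h g hg, pow_mem_lowerPSeries hg', sigma_pow hn hg'⟩

theorem three_mul_finrank_layerSpace_le [LinearOrder α] [Finite α] {z x y : α} (hx : ∀ a, a ≤ x)
    (hxz : x ≠ z) (hyz : y ≠ z) (hxy : x ≠ y) {n : ℕ} (hn : 2 ≤ n)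
    {K K' : Subgroup (FreeGroup α)} (h : ∀ g ∈ K, g ^ p ∈ K') (h' : ∀ g ∈ K, ∀ x, ⁅g, x⁆ ∈ K') :
    3 * Module.finrank (ZMod p) (layerSpace (p := p) (one_le_two.trans hn) K) ≤
      2 * Module.finrank (ZMod p) (layerSpace (p := p) (Nat.le_add_left 1 n) K') := by
  have hn1 := one_le_two.trans hn
  have hS := layerSpace_support (p := p) hn1 K
  have hS' := layerSpace_support (p := p) (Nat.le_add_left 1 n) K'
  rw [finrank_eq_ncard_leads (key_injective z) (List.finite_length_le α n) hS,
    finrank_eq_ncard_leads (key_injective z) (List.finite_length_le α (n + 1)) hS']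
  set A := leads (key z) (layerSpace (p := p) hn1 K : Set (List α → ZMod p)) with hA
  set B := leads (key z) (layerSpace (p := p) (Nat.le_add_left 1 n) K' : Set (List α → ZMod p))
    with hB
  have hAfin : A.Finite := (List.finite_length_le α n).subset (leads_subset hS)
  have hBfin : B.Finite := (List.finite_length_le α (n + 1)).subset (leads_subset hS')
  rw [Set.ncard_eq_toFinset_card _ hAfin, Set.ncard_eq_toFinset_card _ hBfin]
  have hbr {g : FreeGroup α} (hg : g ∈ K) (hg' : g ∈ lowerPSeries p (FreeGroup α) n) (a : α) :
      bracketX a (sigma p n g) ∈ layerSpace (p := p) (Nat.le_add_left 1 n) K' :=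
    ⟨⁅g, FreeGroup.of a⁆, h' g hg _, commutator_mem_lowerPSeries hg' _, sigma_commutator hg' a⟩
  refine card_le_of_cons_append_mem (z := z) (x := x) (y := y) hxz hyz hxy ?_ ?_ ?_ ?_ ?_ ?_ <;>
    intro u hu <;> rw [Set.Finite.mem_toFinset] at hu <;>
    obtain ⟨_, ⟨g, hg, hg', rfl⟩, hu0, hmax⟩ := hu
  · rintro rfl
    exact hu0 (sigma_nil n g)
  · intro hl c
    by_contra! hc
    -- If u = c^k with k ≥ 2 is leading, the coefficient at c vanishes because shorter words have
    -- larger keys; then the one at c^k vanishes too.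
    have hrep : u = List.replicate u.length c := List.eq_replicate_iff.2 ⟨rfl, hc⟩
    have h1 : sigma p n g [c] = 0 := by
      by_contra h1
      have h2 := hmax _ h1
      rw [key_le_iff, List.length_singleton] at h2
      omega
    rw [hrep] at hu0
    exact hu0 (sigma_replicate hn1 hg' h1 _)
  · rw [Set.Finite.mem_toFinset]
    exact ⟨_, ⟨g ^ p, h g hg, pow_mem_lowerPSeries hg', sigma_pow hn hg'⟩, hu0, hmax⟩
  · intro hzu a ha
    rw [Set.Finite.mem_toFinset]
    exact ⟨_, hbr hg hg' a, lead_bracketX_cons hu0 hmax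
      fun w hw => key_append_lt_cons_of_mem ha hzu hw⟩
  · intro hzu hux
    rw [Set.Finite.mem_toFinset]
    exact ⟨_, hbr hg hg' x, lead_bracketX_cons hu0 hmax
      fun w hw => key_append_lt_cons_of_notMem hx hxz hzu hux hw⟩
  · intro huz
    rw [Set.Finite.mem_toFinset]
    exact ⟨_, hbr hg hg' z, lead_bracketX_append hu0 hmax
      fun w hw => key_cons_lt_append huz hw⟩

end LayerSpace

end NCSeries

/-! ### Passage to quotients, and ranks -/

section Quotients

variable {p : ℕ} {H H' : Type*} [Group H] [Group H']

theorem map_lowerPSeries (π : H →* H') (hπ : Function.Surjective π) (n : ℕ) :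
    (lowerPSeries p H n).map π = lowerPSeries p H' n := by
  have h1 : (⊤ : Subgroup H).map π = ⊤ := Subgroup.map_top_of_surjective π hπ
  rcases Nat.eq_zero_or_pos n with rfl | hn
  · exact h1
  induction n, hn using Nat.le_induction with
  | base => exact h1
  | succ n hn ih =>
    refine le_antisymm (Subgroup.map_le_iff_le_comap.2 (lowerPSeries_le hn ?_ ?_))
      (lowerPSeries_le hn ?_ ?_)
    · intro g hg
      rw [Subgroup.mem_comap, map_pow]
      exact pow_mem_lowerPSeries (ih ▸ Subgroup.mem_map_of_mem π hg)
    · intro g hg h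
      rw [Subgroup.mem_comap, map_commutatorElement]
      exact commutator_mem_lowerPSeries (ih ▸ Subgroup.mem_map_of_mem π hg) _
    · rw [← ih]
      rintro _ ⟨g, hg, rfl⟩
      exact ⟨g ^ p, pow_mem_lowerPSeries hg, map_pow π g p⟩
    · rw [← ih]
      rintro _ ⟨g, hg, rfl⟩ h
      obtain ⟨h, rfl⟩ := hπ h
      exact ⟨⁅g, h⁆, commutator_mem_lowerPSeries hg h, map_commutatorElement π g h⟩

theorem map_mem_lowerPSeries_iff {π : H →* H'} (hπ : Function.Surjective π) {m n : ℕ}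
    (hker : π.ker ≤ lowerPSeries p H n) (hmn : m ≤ n) {g : H} :
    π g ∈ lowerPSeries p H' m ↔ g ∈ lowerPSeries p H m := by
  rw [← map_lowerPSeries π hπ, ← Subgroup.mem_comap, Subgroup.comap_map_eq, sup_eq_left.2]
  exact hker.trans (lowerPSeries_anti hmn)

theorem pow_mem_secondTerm {U : Subgroup H} {g : H} (hg : g ∈ U) : g ^ p ∈ secondTerm p U :=
  ⟨(⟨g, hg⟩ : U) ^ p, pow_mem_lowerPSeries (n := 1) (Subgroup.mem_top _), rfl⟩

end Quotients

section Rank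

variable {p : ℕ} [Fact p.Prime]

/-- Scalars in F_p are represented by natural numbers, so generating as a group and spanning are the
same. -/
theorem rank_multiplicative_eq_finrank (V : Type*) [AddCommGroup V] [Module (ZMod p) V]
    [Module.Finite (ZMod p) V] [Group.FG (Multiplicative V)] :
    Group.rank (Multiplicative V) = Module.finrank (ZMod p) V := by
  classical
  refine le_antisymm ?_ ?_
  · let b := Module.finBasis (ZMod p) V
    have h1 : Subgroup.closure
        ((Finset.univ.image fun i => Multiplicative.ofAdd (b i) : Finset (Multiplicative V)) :
          Set (Multiplicative V)) = ⊤ := by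
      rw [eq_top_iff]
      intro v _
      have hv : Multiplicative.toAdd v ∈ Submodule.span (ZMod p) (Set.range b) := by
        rw [b.span_eq]; trivial
      rw [← ofAdd_toAdd v]
      generalize Multiplicative.toAdd v = v at hv
      induction hv using Submodule.span_induction with
      | mem x hx =>
        obtain ⟨i, rfl⟩ := hx
        exact Subgroup.subset_closure (by simp)
      | zero => exact one_mem _
      | add x y _ _ hx hy => exact mul_mem hx hy
      | smul c x _ hx =>
        rw [← ZMod.natCast_zmod_val c, Nat.cast_smul_eq_nsmul, ofAdd_nsmul]
        exact pow_mem hx _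
    exact (Group.rank_le h1).trans (Finset.card_image_le.trans (by simp))
  · obtain ⟨S, hS, hcl⟩ := Group.rank_spec (Multiplicative V)
    rw [← hS]
    have h1 : Submodule.span (ZMod p) ((S.image Multiplicative.toAdd : Finset V) : Set V) = ⊤ := by
      rw [eq_top_iff]
      intro v _
      have hv : Multiplicative.ofAdd v ∈ Subgroup.closure (S : Set (Multiplicative V)) := by
        rw [hcl]; trivial
      rw [← toAdd_ofAdd v]
      generalize Multiplicative.ofAdd v = v at hv
      induction hv using Subgroup.closure_induction with
      | mem x hx =>
        exact Submodule.subset_span (Finset.mem_coe.2 (Finset.mem_image_of_mem _ hx))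
      | one => exact zero_mem _
      | mul x y _ _ hx hy => exact add_mem hx hy
      | inv x _ hx => exact neg_mem hx
    have h2 := finrank_span_finset_le_card (R := ZMod p) (S.image Multiplicative.toAdd)
    rw [Set.finrank, h1, finrank_top] at h2
    exact h2.trans Finset.card_image_le

variable {H : Type*} [Group H]

open NCSeries in
/-- The layers of a quotient of a free group by a small enough normal subgroup. -/
theorem exists_fg_rank_layer {α : Type*} [LinearOrder α] [Finite α] {π : FreeGroup α →* H}
    (hπ : Function.Surjective π) {n : ℕ} (hn : 1 ≤ n)
    (hker : π.ker ≤ lowerPSeries p (FreeGroup α) (n + 1)) (K : Subgroup H) :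
    ∃ _ : Group.FG (layer p K n),
      Group.rank (layer p K n) = Module.finrank (ZMod p) (layerSpace (p := p) hn (K.comap π)) := by
  let L : Subgroup (FreeGroup α) := K.comap π ⊓ lowerPSeries p (FreeGroup α) n
  let V := layerSpace (p := p) hn (K.comap π)
  let ψ : L →* H ⧸ lowerPSeries p H (n + 1) :=
    ((QuotientGroup.mk' (lowerPSeries p H (n + 1))).comp π).comp L.subtype
  let φ : L →* Multiplicative V :=
    MonoidHom.mk' (fun g => Multiplicative.ofAdd ⟨sigma p n (g : FreeGroup α), g, g.2.1, g.2.2, rfl⟩)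
      fun g h => congrArg Multiplicative.ofAdd (Subtype.ext (sigma_mul hn g.2.2 h.2.2))
  have hφ : Function.Surjective φ := by
    rintro ⟨_, g, hg, hg', rfl⟩
    exact ⟨⟨g, hg, hg'⟩, rfl⟩
  have hψ : ψ.range = layer p K n := by
    rw [layer, Subgroup.map_sup, QuotientGroup.map_mk'_self, sup_bot_eq]
    ext q
    constructor
    · rintro ⟨g, rfl⟩
      exact ⟨π g, ⟨g.2.1, (map_mem_lowerPSeries_iff hπ hker (Nat.le_succ n)).2 g.2.2⟩, rfl⟩
    · rintro ⟨h, ⟨hK, hh⟩, rfl⟩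
      obtain ⟨g, rfl⟩ := hπ h
      exact ⟨⟨g, hK, (map_mem_lowerPSeries_iff hπ hker (Nat.le_succ n)).1 hh⟩, rfl⟩
  -- Both kernels consist of the elements of P_{n+1}: for ψ because P_{n+1} contains the kernel of
  -- π, for φ by injectivity of `sigma` on the layer.
  have hkers : ψ.ker = φ.ker := by
    ext g
    rw [MonoidHom.mem_ker, MonoidHom.mem_ker]
    have h1 : ψ g = 1 ↔ π g ∈ lowerPSeries p H (n + 1) := QuotientGroup.eq_one_iff _
    have h2 : φ g = 1 ↔ sigma p n (g : FreeGroup α) = 0 := by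
      rw [← toAdd_eq_zero, ← Submodule.coe_eq_zero]
      rfl
    rw [h1, h2, sigma_eq_zero_iff hn g.2.2, map_mem_lowerPSeries_iff hπ hker le_rfl]
  let e : layer p K n ≃* Multiplicative V :=
    ((MulEquiv.subgroupCongr hψ).symm.trans (QuotientGroup.quotientKerEquivRange ψ).symm).trans
      ((QuotientGroup.quotientMulEquivOfEq hkers).trans
        (QuotientGroup.quotientKerEquivOfSurjective φ hφ))
  have : Finite V := Module.finite_of_finite (ZMod p)
  have hV : Finite (Multiplicative V) := this
  have hFG : Group.FG (Multiplicative V) := inferInstance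
  have hFG' : Group.FG (layer p K n) := by
    have : Finite (layer p K n) := Finite.of_equiv _ e.symm.toEquiv
    infer_instance
  exact ⟨hFG', (Group.rank_congr e).trans (rank_multiplicative_eq_finrank V)⟩

/-- The rank inequalities for a quotient of a free group by a small enough normal subgroup. -/
theorem rank_layer_le {d n : ℕ} (hd : 3 ≤ d) (hn : 2 ≤ n) {π : FreeGroup (Fin d) →* H}
    (hπ : Function.Surjective π) (hker : π.ker ≤ lowerPSeries p (FreeGroup (Fin d)) (n + 2))
    (U : Subgroup H) :
    ∃ (_ : Group.FG (layer p U n)) (_ : Group.FG (layer p (secondTerm p U) (n + 1)))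
      (_ : Group.FG (layer p (powComm p U) (n + 1))),
      Group.rank (layer p U n) ≤ Group.rank (layer p (secondTerm p U) (n + 1)) ∧
      (3 / 2 : ℚ) * (Group.rank (layer p U n) : ℚ) ≤
        (Group.rank (layer p (powComm p U) (n + 1)) : ℚ) := by
  obtain ⟨hQ, hQr⟩ := exists_fg_rank_layer hπ (one_le_two.trans hn)
    (hker.trans (lowerPSeries_succ_le (n + 1))) U
  obtain ⟨hR, hRr⟩ := exists_fg_rank_layer hπ (Nat.le_add_left 1 n) hker (secondTerm p U)
  obtain ⟨hS, hSr⟩ := exists_fg_rank_layer hπ (Nat.le_add_left 1 n) hker (powComm p U)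
  refine ⟨hQ, hR, hS, ?_, ?_⟩
  · rw [hQr, hRr]
    refine NCSeries.finrank_layerSpace_le hn fun g hg => ?_
    rw [Subgroup.mem_comap, map_pow]
    exact pow_mem_secondTerm hg
  · rw [hQr, hSr]
    -- Only x has to be the largest letter; d ≥ 3 makes the three letters distinct.
    have h := NCSeries.three_mul_finrank_layerSpace_le (p := p) (α := Fin d)
      (z := ⟨0, by omega⟩) (x := ⟨d - 1, by omega⟩) (y := ⟨1, by omega⟩)
      (fun a => Fin.le_def.2 (by simp only; omega))
      (by simp only [ne_eq, Fin.mk.injEq]; omega) (by simp)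
      (by simp only [ne_eq, Fin.mk.injEq]; omega) hn (K := U.comap π)
      (K' := (powComm p U).comap π)
      (fun g hg => by rw [Subgroup.mem_comap, map_pow]; exact pow_mem_powComm (K := U) hg)
      (fun g hg x => by
        rw [Subgroup.mem_comap, map_commutatorElement]; exact commutator_mem_powComm (K := U) hg (π x))
    have h' := (Nat.cast_le (α := ℚ)).2 h
    push_cast at h'
    linarith

end Rank
theorem mainTheorem6 (p : ℕ) [Fact p.Prime] (d n : ℕ) (hd : 3 ≤ d) (hn : 2 ≤ n) :
    (∀ U : Subgroup (FreeGroup (Fin d)), U.Normal →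
      U ≤ lowerPSeries p (FreeGroup (Fin d)) 2 →
      ∃ (_ : Group.FG (layer p U n))
        (_ : Group.FG (layer p (secondTerm p U) (n + 1)))
        (_ : Group.FG (layer p (powComm p U) (n + 1))),
        Group.rank (layer p U n) ≤ Group.rank (layer p (secondTerm p U) (n + 1)) ∧
        (3 / 2 : ℚ) * (Group.rank (layer p U n) : ℚ) ≤
          (Group.rank (layer p (powComm p U) (n + 1)) : ℚ)) ∧
    (∀ i : ℕ, 2 ≤ i → i < n →
      ∀ U : Subgroup (FreeGroup (Fin d) ⧸ lowerPSeries p (FreeGroup (Fin d)) (n + 1)),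
      U.Normal →
      U ≤ lowerPSeries p (FreeGroup (Fin d) ⧸ lowerPSeries p (FreeGroup (Fin d)) (n + 1)) 2 →
      ∃ (_ : Group.FG (layer p U i))
        (_ : Group.FG (layer p (secondTerm p U) (i + 1)))
        (_ : Group.FG (layer p (powComm p U) (i + 1))),
        Group.rank (layer p U i) ≤ Group.rank (layer p (secondTerm p U) (i + 1)) ∧
        (3 / 2 : ℚ) * (Group.rank (layer p U i) : ℚ) ≤
          (Group.rank (layer p (powComm p U) (i + 1)) : ℚ)) := by
  refine ⟨fun U _ _ => ?_, fun i hi hin U _ _ => ?_⟩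
  · refine rank_layer_le hd hn (π := MonoidHom.id _) Function.surjective_id ?_ U
    rw [MonoidHom.ker_id]
    exact bot_le
  · refine rank_layer_le hd hi (QuotientGroup.mk'_surjective _) ?_ U
    rw [QuotientGroup.ker_mk']
    -- The kernel P_{n+1} lies in P_{i+2} because i < n.
    exact lowerPSeries_anti (by omega)
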